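/- Let $c\in\mathbb{R}$ and let $\mathbb{H}_c=L^2(\mathbb{R},e^{-2ct}\,dt)$ (complex-valued functions). Let $\partial=\partial_c$ be the unbounded normal operator $\partial f=f'$ on $\mathbb{H}_c$, whose domain consists of all locally absolutely continuous $f\in\mathbb{H}_c$ with $f'\in\mathbb{H}_c$; its spectrum is the line $\{\mathrm{Re}(s)=c\}$. For each $T>0$ let $\varphi^{(T)}:\{\mathrm{Re}(s)=c\}\to\mathbb{C}$ be a cut-off function, that is, a continuous function such that the closure of $\varphi^{(T)}(\{\mathrm{Re}(s)=c\})$ is the segment $[c-iT,c+iT]$ and which, when $c=1$, has a meromorphic continuation to a connected open neighbourhood of $\{\mathrm{Re}(s)=1\}$. Using the functional calculus for (possibly unbounded) normal operators, put $\partial^{(T)}=\varphi^{(T)}(\partial)$ and $\mathfrak{a}^{(T)}=\zeta(\partial^{(T)})$, where $\zeta$ is the Riemann zeta function, continued meromorphically to $\mathbb{C}$. The spectral operator $\mathfrak{a}_c=\zeta(\partial)$ is called quasi-invertible if, for every $T>0$, the truncation $\mathfrak{a}^{(T)}$ is invertible, i.e. is a bijection from its domain onto $\mathbb{H}_c$ with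 bounded inverse. Then, for every $c\in\mathbb{R}$ and every such family of cut-off functions $(\varphi^{(T)})_{T>0}$, the spectral operator $\mathfrak{a}_c$ is quasi-invertible if and only if $\zeta$ has no zeros on the vertical line $\{\mathrm{Re}(s)=c\}$. -/

import Mathlib

open MeasureTheory

noncomputable section

namespace SpectralOperator

/-! ### Unbounded operators and the functional calculus

A possibly unbounded operator on `H` is a `LinearPMap`, written `H →ₗ.[ℂ] H`. -/

section General

variable {X : Type*} [MeasurableSpace X]
variable {H K : Type*} [NormedAddCommGroup H] [InnerProductSpace ℂ H]
  [NormedAddCommGroup K] [InnerProductSpace ℂ K]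

/-- The maximal operator of multiplication by `g` in `L²(X, μ)`, with domain
`{u ∈ L²(μ) : g u ∈ L²(μ)}`. -/
def mulOperator (μ : Measure X) (g : X → ℂ) : Lp ℂ 2 μ →ₗ.[ℂ] Lp ℂ 2 μ where
  domain :=
    { carrier := {u | MemLp (fun x => g x * u x) 2 μ}
      add_mem' := by
        intro u v hu hv
        refine (MemLp.add hu hv).ae_eq ?_
        filter_upwards [Lp.coeFn_add u v] with x hx
        rw [hx]
        simp only [Pi.add_apply]
        ring
      zero_mem' := by
        refine (MemLp.zero (ε := ℂ)).ae_eq ?_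
        filter_upwards [Lp.coeFn_zero ℂ 2 μ] with x hx
        rw [hx]
        simp only [Pi.zero_apply, mul_zero]
      smul_mem' := by
        intro a u hu
        refine (MemLp.const_smul hu a).ae_eq ?_
        filter_upwards [Lp.coeFn_smul a u] with x hx
        simp [hx]
        ring }
  toFun :=
    { toFun := fun u => MemLp.toLp (fun x => g x * (u : Lp ℂ 2 μ) x) u.2
      map_add' := by
        intro u v
        rw [← MemLp.toLp_add, MemLp.toLp_eq_toLp_iff]
        filter_upwards [Lp.coeFn_add (u : Lp ℂ 2 μ) v] with x hx
        simp only [Submodule.coe_add, Pi.add_apply]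
        rw [hx]
        simp only [Pi.add_apply]
        ring
      map_smul' := by
        intro a u
        rw [RingHom.id_apply, ← MemLp.toLp_const_smul, MemLp.toLp_eq_toLp_iff]
        filter_upwards [Lp.coeFn_smul a (u : Lp ℂ 2 μ)] with x hx
        simp [hx]
        ring }

/-- The operator `U⁻¹ B U` on `H`, for a unitary `U` from `H` onto `K` and an operator `B` on
`K`; its domain is `U⁻¹(D(B))`. -/
def unitaryConj (U : H ≃ₗᵢ[ℂ] K) (B : K →ₗ.[ℂ] K) : H →ₗ.[ℂ] H where
  domain := B.domain.comap (U.toLinearEquiv : H →ₗ[ℂ] K)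
  toFun :=
    { toFun := fun x => U.symm (B ⟨U x, x.2⟩)
      map_add' := by
        intro x y
        rw [← map_add, ← LinearPMap.map_add]
        congr 2
        ext
        simp
      map_smul' := by
        intro a x
        rw [RingHom.id_apply, ← map_smul, ← LinearPMap.map_smul]
        congr 2
        ext
        simp }

/-- A spectral representation of the operator `A`: a unitary map `U` of `H` onto some `L²(X, μ)`,
with `μ` `σ`-finite, under which `A` becomes multiplication by `g`, that is
`A = U⁻¹ M_g U`, domains included. By the spectral theorem, the operators on a separable Hilbert
space that have one are exactly the (closed, densely defined, possibly unbounded) normal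
operators. -/
structure SpectralRepresentation (A : H →ₗ.[ℂ] H) where
  X : Type
  [measurableSpace : MeasurableSpace X]
  μ : Measure X
  [sigmaFinite : SigmaFinite μ]
  g : X → ℂ
  aemeasurable_g : AEMeasurable g μ
  U : H ≃ₗᵢ[ℂ] Lp ℂ 2 μ
  eq_conj : A = unitaryConj U (mulOperator μ g)

attribute [instance] SpectralRepresentation.measurableSpace SpectralRepresentation.sigmaFinite

/-- The operator `U⁻¹ M_{f ∘ g} U`, where `A = U⁻¹ M_g U`. -/
def SpectralRepresentation.eval {A : H →ₗ.[ℂ] H} (R : SpectralRepresentation A) (f : ℂ → ℂ) :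
    H →ₗ.[ℂ] H :=
  unitaryConj R.U (mulOperator R.μ (f ∘ R.g))

open Classical in
/-- The Borel functional calculus `f(A)` of a possibly unbounded normal operator `A` on a
separable Hilbert space: if `A = U⁻¹ M_g U`, then `f(A) = U⁻¹ M_{f ∘ g} U`, with its maximal
domain. For `f` Borel on the spectrum of `A`, this does not depend on the spectral
representation, nor on the values of `f` off the spectrum of `A`. (For an operator without a
spectral representation, i.e. one that is not normal, the value is the operator with domain
`{0}`, which carries no meaning.) -/
def functionalCalculus (A : H →ₗ.[ℂ] H) (f : ℂ → ℂ) : H →ₗ.[ℂ] H :=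
  if h : Nonempty (SpectralRepresentation A) then h.some.eval f else ⊥

/-- A possibly unbounded operator `L` is invertible if it is a bijection from its domain onto `H`
and its inverse is bounded. -/
def IsInvertible (L : H →ₗ.[ℂ] H) : Prop :=
  Function.Bijective (fun x : L.domain => L x) ∧
    ∃ C : ℝ, ∀ x : L.domain, ‖(x : H)‖ ≤ C * ‖L x‖

end General

/-! ### The infinitesimal shift -/

/-- The measure `e^{-2ct} dt` on the real line. -/
def weight (c : ℝ) : Measure ℝ :=
  volume.withDensity fun t => ENNReal.ofReal (Real.exp (-2 * c * t))

/-- The complex Hilbert space `ℍ_c = L²(ℝ, e^{-2ct} dt)`. -/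
abbrev Hc (c : ℝ) : Type := Lp ℂ 2 (weight c)

/-- `F` is locally absolutely continuous on the real line. -/
def LocallyAbsCont (F : ℝ → ℂ) : Prop := ∀ a b : ℝ, AbsolutelyContinuousOnInterval F a b

/-- `F` is a locally absolutely continuous representative of `f ∈ ℍ_c`, and its (almost
everywhere defined) derivative belongs to `ℍ_c`. -/
structure IsACRep (c : ℝ) (f : Hc c) (F : ℝ → ℂ) : Prop where
  absCont : LocallyAbsCont F
  ae_eq : f =ᵐ[weight c] F
  memLp_deriv : MemLp (deriv F) 2 (weight c)

lemma LocallyAbsCont.continuous {F : ℝ → ℂ} (hF : LocallyAbsCont F) : Continuous F := by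
  rw [continuous_iff_continuousAt]
  intro x
  have h := (hF (x - 1) (x + 1)).continuousOn
  rw [Set.uIcc_of_le (by linarith)] at h
  exact h.continuousAt (Icc_mem_nhds (by linarith) (by linarith))

lemma LocallyAbsCont.ae_differentiableAt {F : ℝ → ℂ} (hF : LocallyAbsCont F) :
    ∀ᵐ t ∂(volume : Measure ℝ), DifferentiableAt ℝ F t := by
  apply LocallyBoundedVariationOn.ae_differentiableAt
  intro a b _ _
  rcases le_total a b with hab | hab
  · have h := (hF a b).boundedVariationOn
    rw [Set.uIcc_of_le hab] at h
    exact h.mono (by simp)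
  · have h : BoundedVariationOn F ∅ := by simp [BoundedVariationOn]
    rcases hab.eq_or_lt with rfl | hlt
    · have h := (hF b b).boundedVariationOn
      rw [Set.uIcc_of_le le_rfl] at h
      exact h.mono (by simp)
    · rw [Set.Icc_eq_empty (not_le.mpr hlt), Set.inter_empty]
      exact h

lemma weight_absolutelyContinuous (c : ℝ) : weight c ≪ volume :=
  withDensity_absolutelyContinuous _ _

lemma absolutelyContinuous_weight (c : ℝ) : volume ≪ weight c := by
  refine withDensity_absolutelyContinuous' ?_ ?_
  · exact Measurable.aemeasurable (by fun_prop)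
  · exact Filter.Eventually.of_forall fun t => by simp [Real.exp_pos]

/-- The locally absolutely continuous representative is unique. -/
lemma IsACRep.unique {c : ℝ} {f : Hc c} {F G : ℝ → ℂ} (hF : IsACRep c f F)
    (hG : IsACRep c f G) : F = G := by
  have h : F =ᵐ[weight c] G := hF.ae_eq.symm.trans hG.ae_eq
  exact (Continuous.ae_eq_iff_eq volume hF.absCont.continuous hG.absCont.continuous).1
    ((absolutelyContinuous_weight c).ae_eq h)

lemma deriv_add_ae {c : ℝ} {F G : ℝ → ℂ} (hF : LocallyAbsCont F) (hG : LocallyAbsCont G) :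
    deriv F + deriv G =ᵐ[weight c] deriv (F + G) := by
  apply (weight_absolutelyContinuous c).ae_le
  filter_upwards [hF.ae_differentiableAt, hG.ae_differentiableAt] with t h1 h2
  simp [deriv_add h1 h2]

lemma deriv_smul_eq (a : ℂ) (F : ℝ → ℂ) : a • deriv F = deriv (a • F) := by
  ext t
  exact (deriv_const_smul_field a F).symm

lemma IsACRep.add {c : ℝ} {f g : Hc c} {F G : ℝ → ℂ} (hF : IsACRep c f F)
    (hG : IsACRep c g G) : IsACRep c (f + g) (F + G) where
  absCont := fun a b => (hF.absCont a b).add (hG.absCont a b)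
  ae_eq := (Lp.coeFn_add f g).trans (hF.ae_eq.add hG.ae_eq)
  memLp_deriv := (hF.memLp_deriv.add hG.memLp_deriv).ae_eq (deriv_add_ae hF.absCont hG.absCont)

lemma IsACRep.smul {c : ℝ} {f : Hc c} {F : ℝ → ℂ} (a : ℂ) (hF : IsACRep c f F) :
    IsACRep c (a • f) (a • F) where
  absCont := fun x y => (hF.absCont x y).const_smul a
  ae_eq := (Lp.coeFn_smul a f).trans (hF.ae_eq.const_smul a)
  memLp_deriv := by
    rw [← deriv_smul_eq]
    exact hF.memLp_deriv.const_smul a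

lemma IsACRep.zero (c : ℝ) : IsACRep c 0 0 where
  absCont := fun a b => by
    have h : LipschitzOnWith 0 (0 : ℝ → ℂ) (Set.uIcc a b) :=
      (LipschitzWith.const (0 : ℂ)).lipschitzOnWith
    exact h.absolutelyContinuousOnInterval
  ae_eq := Lp.coeFn_zero ℂ 2 (weight c)
  memLp_deriv := by
    have h : deriv (0 : ℝ → ℂ) = fun _ => 0 := by ext; simp
    rw [h]
    exact MemLp.zero

/-- The infinitesimal shift `∂ = d/dt` on `ℍ_c`: its domain consists of the locally absolutely
continuous `f ∈ ℍ_c` with `f' ∈ ℍ_c`, and `∂ f = f'`. -/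
def infinitesimalShift (c : ℝ) : Hc c →ₗ.[ℂ] Hc c where
  domain :=
    { carrier := {f | ∃ F, IsACRep c f F}
      add_mem' := fun ⟨F, hF⟩ ⟨G, hG⟩ => ⟨F + G, hF.add hG⟩
      zero_mem' := ⟨0, IsACRep.zero c⟩
      smul_mem' := fun a _ ⟨F, hF⟩ => ⟨a • F, hF.smul a⟩ }
  toFun :=
    { toFun := fun f => MemLp.toLp (deriv f.2.choose) f.2.choose_spec.memLp_deriv
      map_add' := by
        intro f g
        rw [← MemLp.toLp_add, MemLp.toLp_eq_toLp_iff,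
          (f + g).2.choose_spec.unique (f.2.choose_spec.add g.2.choose_spec)]
        exact (deriv_add_ae f.2.choose_spec.absCont g.2.choose_spec.absCont).symm
      map_smul' := by
        intro a f
        rw [RingHom.id_apply, ← MemLp.toLp_const_smul, MemLp.toLp_eq_toLp_iff,
          (a • f).2.choose_spec.unique (f.2.choose_spec.smul a), deriv_smul_eq] }

/-! ### Truncations and quasi-invertibility -/

/-- The vertical line `{Re s = c}`, which is the spectrum of `∂` on `ℍ_c`. -/
def verticalLine (c : ℝ) : Set ℂ := {s | s.re = c}

/-- `φ` is an admissible cut-off function at height `T`: it is continuous on `{Re s = c}`, the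
closure of `φ({Re s = c})` is the segment `[c - iT, c + iT]`, and, when `c = 1`, `φ` extends
meromorphically to a connected open neighbourhood of `{Re s = 1}`. Only the values of `φ` on
`{Re s = c}` matter. -/
structure IsCutoff (c T : ℝ) (φ : ℂ → ℂ) : Prop where
  continuousOn : ContinuousOn φ (verticalLine c)
  closure_image : closure (φ '' verticalLine c) = {s : ℂ | s.re = c ∧ |s.im| ≤ T}
  meromorphic : c = 1 → ∃ (V : Set ℂ) (g : ℂ → ℂ), IsOpen V ∧ IsConnected V ∧
    verticalLine c ⊆ V ∧ MeromorphicOn g V ∧ Set.EqOn g φ (verticalLine c)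

/-- The truncated infinitesimal shift `∂^{(T)} = φ^{(T)}(∂)`. -/
def truncatedShift (c : ℝ) (φ : ℂ → ℂ) : Hc c →ₗ.[ℂ] Hc c :=
  functionalCalculus (infinitesimalShift c) φ

/-- The truncated spectral operator `𝔞^{(T)} = ζ(∂^{(T)})`. -/
def truncatedSpectralOperator (c : ℝ) (φ : ℂ → ℂ) : Hc c →ₗ.[ℂ] Hc c :=
  functionalCalculus (truncatedShift c φ) riemannZeta

/-- The spectral operator `𝔞 = ζ(∂)` on `ℍ_c` is quasi-invertible, relative to the family of
cut-off functions `φ^{(T)}`, if each of its truncations `𝔞^{(T)}`, `T > 0`, is invertible. -/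
def IsQuasiInvertible (c : ℝ) (φ : ℝ → ℂ → ℂ) : Prop :=
  ∀ T : ℝ, 0 < T → IsInvertible (truncatedSpectralOperator c (φ T))

end SpectralOperator

end

/-! The functional calculus is computed in an arbitrarily chosen spectral representation, and the
choice is made afresh for `truncatedShift` and again for `ζ` of it. Its full independence of the
choice is not needed. Two invariants of an operator `A = U⁻¹ M_g U` suffice. The essential range of
`g` is the set of approximate eigenvalues of `A`, and the values that `g` takes on a set of positive
measure are the eigenvalues of `A` (`SpectralRepresentation.support_eq`,
`SpectralRepresentation.ae_ne_iff`).

After multiplication by `e^{-ct}`, the Fourier transform turns `∂` into multiplication by `c + 2πiξ`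
(`fourierRepresentation`). Hence every symbol of `∂` has essential range `{Re s = c}` and takes no
value on a set of positive measure. By `support_map_comp`, the symbol of the truncation has
essential range `closure (φ '' verticalLine c)`, the compact segment.

An operator is invertible iff its symbol is essentially bounded away from `0`. For `ζ` on the
segment this means having no zeros: a zero would make `ζ` small on a set of positive measure, and
conversely compactness gives a lower bound, since `‖ζ‖` tends to infinity at the pole.

The value assigned to `ζ` at `1` must not matter, so the symbol has to avoid `1` almost everywhere.
For `c = 1` this is what the meromorphy of `φ` provides: `φ = 1` holds at countably many points of
the line, and none of them is an eigenvalue of `∂`. Every point of the line lies in some segment,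
which gives the theorem. -/

open MeasureTheory

noncomputable section

namespace SpectralOperator

/-! ### Spectral representations: invariants and invertibility -/

section General

variable {X : Type*} [MeasurableSpace X]
variable {H K : Type*} [NormedAddCommGroup H] [InnerProductSpace ℂ H]
  [NormedAddCommGroup K] [InnerProductSpace ℂ K]

/-- `z` is an approximate eigenvalue of `A`. -/
def IsApproxEigenvalue (A : H →ₗ.[ℂ] H) (z : ℂ) : Prop :=
  ∀ ε : ℝ, 0 < ε → ∃ u : A.domain, (u : H) ≠ 0 ∧ ‖A u - z • (u : H)‖ ≤ ε * ‖(u : H)‖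

/-- `z` is an eigenvalue of `A`. -/
def IsEigenvalue (A : H →ₗ.[ℂ] H) (z : ℂ) : Prop :=
  ∃ u : A.domain, (u : H) ≠ 0 ∧ A u = z • (u : H)

lemma unitaryConj_apply (U : H ≃ₗᵢ[ℂ] K) (B : K →ₗ.[ℂ] K) (x : (unitaryConj U B).domain) :
    unitaryConj U B x = U.symm (B ⟨U x, x.2⟩) := rfl

/-- A general predicate `P` lets one transfer along `U` serve approximate eigenvalues, eigenvalues
and surjectivity. -/
lemma exists_domain_unitaryConj_iff (U : H ≃ₗᵢ[ℂ] K) (B : K →ₗ.[ℂ] K) {P : H → H → Prop} :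
    (∃ x : (unitaryConj U B).domain, P x (unitaryConj U B x)) ↔
      ∃ y : B.domain, P (U.symm y) (U.symm (B y)) := by
  constructor
  · rintro ⟨x, hx⟩
    refine ⟨⟨U x, x.2⟩, ?_⟩
    rw [unitaryConj_apply] at hx
    simpa using hx
  · rintro ⟨y, hy⟩
    have hmem : U.symm (y : K) ∈ (unitaryConj U B).domain := by
      change U (U.symm (y : K)) ∈ B.domain
      simp
    refine ⟨⟨U.symm y, hmem⟩, ?_⟩
    rw [unitaryConj_apply]
    convert hy
    simp

lemma isApproxEigenvalue_unitaryConj (U : H ≃ₗᵢ[ℂ] K) (B : K →ₗ.[ℂ] K) (z : ℂ) :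
    IsApproxEigenvalue (unitaryConj U B) z ↔ IsApproxEigenvalue B z := by
  unfold IsApproxEigenvalue
  refine forall₂_congr fun ε _ => ?_
  rw [exists_domain_unitaryConj_iff U B
    (P := fun x y => x ≠ 0 ∧ ‖y - z • x‖ ≤ ε * ‖x‖)]
  refine exists_congr fun y => ?_
  rw [← map_smul, ← map_sub, LinearIsometryEquiv.norm_map, LinearIsometryEquiv.norm_map]
  simp

lemma isEigenvalue_unitaryConj (U : H ≃ₗᵢ[ℂ] K) (B : K →ₗ.[ℂ] K) (z : ℂ) :
    IsEigenvalue (unitaryConj U B) z ↔ IsEigenvalue B z := by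
  unfold IsEigenvalue
  rw [exists_domain_unitaryConj_iff U B (P := fun x y => x ≠ 0 ∧ y = z • x)]
  refine exists_congr fun y => ?_
  rw [← map_smul, U.symm.injective.eq_iff]
  simp

variable {μ : Measure X} {g : X → ℂ}

lemma coeFn_mulOperator (u : (mulOperator μ g).domain) :
    mulOperator μ g u =ᵐ[μ] fun x => g x * (u : Lp ℂ 2 μ) x :=
  MemLp.coeFn_toLp u.2

lemma coeFn_mulOperator_sub_smul (u : (mulOperator μ g).domain) (z : ℂ) :
    (mulOperator μ g u - z • (u : Lp ℂ 2 μ) : Lp ℂ 2 μ) =ᵐ[μ]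
      fun x => (g x - z) * (u : Lp ℂ 2 μ) x := by
  filter_upwards [Lp.coeFn_sub (mulOperator μ g u) (z • (u : Lp ℂ 2 μ)),
    Lp.coeFn_smul z (u : Lp ℂ 2 μ), coeFn_mulOperator u] with x h1 h2 h3
  rw [h1, Pi.sub_apply, h2, h3, Pi.smul_apply, smul_eq_mul]
  ring

/-- A set of positive measure carries a nonzero vector of `L²`, in the domain of multiplication
by `g` if `g` is close to `z` on that set. -/
lemma exists_mulOperator_approx [SigmaFinite μ] (hg : AEMeasurable g μ) {z : ℂ} {ε : ℝ}
    {s : Set X} (hs : NullMeasurableSet s μ) (hpos : μ s ≠ 0) (hle : ∀ x ∈ s, ‖g x - z‖ ≤ ε) :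
    ∃ u : (mulOperator μ g).domain, (u : Lp ℂ 2 μ) ≠ 0 ∧
      ‖mulOperator μ g u - z • (u : Lp ℂ 2 μ)‖ ≤ ε * ‖(u : Lp ℂ 2 μ)‖ := by
  -- The test vector is an indicator function. Passing to a measurable subset and then, by
  -- σ-finiteness, to one of finite positive measure puts it in `L²`.
  obtain ⟨t, hts, ht, hst⟩ := hs.exists_measurable_subset_ae_eq
  have htpos : 0 < μ t := by rw [measure_congr hst]; exact pos_iff_ne_zero.2 hpos
  obtain ⟨r, hr, hrt, hr0, hrtop⟩ := Measure.exists_subset_measure_lt_top ht htpos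
  let u : Lp ℂ 2 μ := indicatorConstLp 2 hr hrtop.ne (1 : ℂ)
  have hu : u =ᵐ[μ] r.indicator fun _ => (1 : ℂ) := indicatorConstLp_coeFn
  have hsub : ∀ᵐ x ∂μ, ‖(g x - z) * u x‖ ≤ ε * ‖u x‖ := by
    filter_upwards [hu] with x hx
    rw [norm_mul, hx]
    by_cases hxr : x ∈ r
    · simpa [hxr] using hle x (hts (hrt hxr))
    · simp [hxr]
  have hmeas : AEStronglyMeasurable (fun x => (g x - z) * u x) μ :=
    (hg.aestronglyMeasurable.sub aestronglyMeasurable_const).mul (Lp.aestronglyMeasurable u)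
  have hmem : MemLp (fun x => (g x - z) * u x) 2 μ := (Lp.memLp u).of_le_mul hmeas hsub
  have hdom : u ∈ (mulOperator μ g).domain := by
    refine (hmem.add ((Lp.memLp u).const_smul z)).ae_eq (.of_forall fun x => ?_)
    simp only [Pi.add_apply, Pi.smul_apply, smul_eq_mul]
    ring
  refine ⟨⟨u, hdom⟩, ?_, ?_⟩
  · intro h0
    have h0 : u = 0 := h0
    have : (r.indicator fun _ => (1 : ℂ)) =ᵐ[μ] 0 :=
      hu.symm.trans (h0 ▸ Lp.coeFn_zero ℂ 2 μ)
    refine hr0.ne' (measure_mono_null (fun x hx => ?_) (ae_iff.1 this))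
    simp [hx]
  · refine Lp.norm_le_mul_norm_of_ae_le_mul ?_
    filter_upwards [hsub, coeFn_mulOperator_sub_smul ⟨u, hdom⟩ z] with x h1 h2
    rw [h2]
    exact h1

/-- Division by `g - z` is bounded by `ε⁻¹`. The case `z = 0` gives injectivity and the bounded
inverse. -/
lemma norm_le_mulOperator_sub_smul {z : ℂ} {ε : ℝ} (hε : 0 < ε) (h : ∀ᵐ x ∂μ, ε ≤ ‖g x - z‖)
    (u : (mulOperator μ g).domain) :
    ‖(u : Lp ℂ 2 μ)‖ ≤ ε⁻¹ * ‖mulOperator μ g u - z • (u : Lp ℂ 2 μ)‖ := by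
  refine Lp.norm_le_mul_norm_of_ae_le_mul ?_
  filter_upwards [h, coeFn_mulOperator_sub_smul u z] with x h1 h2
  rw [h2, norm_mul, ← mul_assoc]
  refine le_mul_of_one_le_left (norm_nonneg _) ?_
  rw [inv_mul_eq_div, one_le_div hε]
  exact h1

lemma mem_support_map_iff (hg : AEMeasurable g μ) {z : ℂ} :
    z ∈ (μ.map g).support ↔ ∀ ε : ℝ, 0 < ε → μ {x | ‖g x - z‖ < ε} ≠ 0 := by
  rw [Metric.nhds_basis_ball.mem_measureSupport]
  refine forall₂_congr fun ε _ => ?_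
  rw [Measure.map_apply_of_aemeasurable hg Metric.isOpen_ball.measurableSet, pos_iff_ne_zero]
  have : g ⁻¹' Metric.ball z ε = {x | ‖g x - z‖ < ε} := by
    ext x
    simp [dist_eq_norm]
  rw [this]

lemma notMem_support_map_iff (hg : AEMeasurable g μ) {z : ℂ} :
    z ∉ (μ.map g).support ↔ ∃ ε : ℝ, 0 < ε ∧ ∀ᵐ x ∂μ, ε ≤ ‖g x - z‖ := by
  rw [mem_support_map_iff hg]
  push Not
  simp only [ae_iff, not_le]

/-- The approximate eigenvalues of multiplication by `g` are the essential values of `g`. -/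
lemma isApproxEigenvalue_mulOperator_iff [SigmaFinite μ] (hg : AEMeasurable g μ) {z : ℂ} :
    IsApproxEigenvalue (mulOperator μ g) z ↔ z ∈ (μ.map g).support := by
  constructor
  · intro h
    by_contra hz
    obtain ⟨ε, hε, hle⟩ := (notMem_support_map_iff hg).1 hz
    obtain ⟨u, hu0, hu⟩ := h (ε / 2) (by positivity)
    have h1 := norm_le_mulOperator_sub_smul hε hle u
    have hpos : 0 < ‖(u : Lp ℂ 2 μ)‖ := norm_pos_iff.2 hu0
    have h2 : ‖(u : Lp ℂ 2 μ)‖ ≤ ε⁻¹ * (ε / 2 * ‖(u : Lp ℂ 2 μ)‖) := h1.trans (by gcongr)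
    have h3 : ε⁻¹ * (ε / 2 * ‖(u : Lp ℂ 2 μ)‖) = ‖(u : Lp ℂ 2 μ)‖ / 2 := by field_simp
    linarith
  · intro h ε hε
    have hs : NullMeasurableSet {x | ‖g x - z‖ < ε} μ :=
      nullMeasurableSet_lt (hg.sub_const z).norm aemeasurable_const
    exact exists_mulOperator_approx hg hs ((mem_support_map_iff hg).1 h ε hε)
      fun x hx => le_of_lt hx

/-- The eigenvalues of multiplication by `g` are the values taken on a set of positive measure. -/
lemma isEigenvalue_mulOperator_iff [SigmaFinite μ] (hg : AEMeasurable g μ) {z : ℂ} :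
    IsEigenvalue (mulOperator μ g) z ↔ ¬ ∀ᵐ x ∂μ, g x ≠ z := by
  constructor
  · rintro ⟨u, hu0, hu⟩ hne
    apply hu0
    rw [Lp.eq_zero_iff_ae_eq_zero]
    have h0 : mulOperator μ g u - z • (u : Lp ℂ 2 μ) = 0 := sub_eq_zero.2 hu
    have h1 := coeFn_mulOperator_sub_smul u z
    rw [h0] at h1
    filter_upwards [h1, Lp.coeFn_zero ℂ 2 μ, hne] with x h2 h3 h4
    rw [h3] at h2
    exact (mul_eq_zero.1 h2.symm).resolve_left (sub_ne_zero.2 h4)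
  · intro h
    have hs : NullMeasurableSet {x | g x = z} μ := by
      exact nullMeasurableSet_eq_fun hg aemeasurable_const
    have hpos : μ {x | g x = z} ≠ 0 := by
      simpa [ae_iff] using h
    -- With `ε = 0` an approximate eigenvector is an exact one.
    obtain ⟨u, hu0, hu⟩ := exists_mulOperator_approx (z := z) (ε := 0) hg hs hpos
      fun x hx => by simp [show g x = z from hx]
    refine ⟨u, hu0, ?_⟩
    rw [zero_mul] at hu
    exact sub_eq_zero.1 (norm_le_zero_iff.1 hu)

lemma SpectralRepresentation.isApproxEigenvalue_iff {A : H →ₗ.[ℂ] H}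
    (R : SpectralRepresentation A) {z : ℂ} :
    IsApproxEigenvalue A z ↔ z ∈ (R.μ.map R.g).support := by
  rw [← isApproxEigenvalue_mulOperator_iff R.aemeasurable_g, ← isApproxEigenvalue_unitaryConj R.U,
    ← R.eq_conj]

lemma SpectralRepresentation.isEigenvalue_iff {A : H →ₗ.[ℂ] H}
    (R : SpectralRepresentation A) {z : ℂ} :
    IsEigenvalue A z ↔ ¬ ∀ᵐ x ∂(R.μ), R.g x ≠ z := by
  rw [← isEigenvalue_mulOperator_iff R.aemeasurable_g, ← isEigenvalue_unitaryConj R.U,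
    ← R.eq_conj]

/-- All spectral representations of an operator have the same essential range. -/
lemma SpectralRepresentation.support_eq {A : H →ₗ.[ℂ] H} (R R' : SpectralRepresentation A) :
    (R.μ.map R.g).support = (R'.μ.map R'.g).support := by
  ext z
  rw [← R.isApproxEigenvalue_iff, R'.isApproxEigenvalue_iff]

lemma SpectralRepresentation.ae_ne_iff {A : H →ₗ.[ℂ] H} (R R' : SpectralRepresentation A)
    {z : ℂ} : (∀ᵐ x ∂(R.μ), R.g x ≠ z) ↔ ∀ᵐ x ∂(R'.μ), R'.g x ≠ z := by
  rw [← not_iff_not, ← R.isEigenvalue_iff, R'.isEigenvalue_iff]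

lemma SpectralRepresentation.ae_mem_support {A : H →ₗ.[ℂ] H} (R : SpectralRepresentation A) :
    ∀ᵐ x ∂(R.μ), R.g x ∈ (R.μ.map R.g).support :=
  ae_of_ae_map R.aemeasurable_g (Measure.support_mem_ae (μ := R.μ.map R.g))

/-- The spectral representation of `f(A)` obtained from one of `A`. -/
def SpectralRepresentation.comp {A : H →ₗ.[ℂ] H} (R : SpectralRepresentation A) (f : ℂ → ℂ)
    (hf : AEMeasurable (f ∘ R.g) R.μ) : SpectralRepresentation (R.eval f) where
  X := R.X
  μ := R.μ
  g := f ∘ R.g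
  aemeasurable_g := hf
  U := R.U
  eq_conj := rfl

/-- Only the existence of `R` is known, so whatever follows must hold for every representation of
`A`. -/
lemma exists_functionalCalculus_eq {A : H →ₗ.[ℂ] H} (hA : Nonempty (SpectralRepresentation A))
    (f : ℂ → ℂ) : ∃ R : SpectralRepresentation A, functionalCalculus A f = R.eval f :=
  ⟨hA.some, dif_pos hA⟩

lemma bijective_unitaryConj (U : H ≃ₗᵢ[ℂ] K) (B : K →ₗ.[ℂ] K)
    (hB : Function.Bijective fun x : B.domain => B x) :
    Function.Bijective fun x : (unitaryConj U B).domain => unitaryConj U B x := by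
  constructor
  · intro x y hxy
    have h := hB.1 (U.symm.injective hxy)
    exact Subtype.ext (U.injective (congrArg Subtype.val h))
  · intro y
    obtain ⟨x, hx⟩ := hB.2 (U y)
    have := (exists_domain_unitaryConj_iff U B (P := fun _ w => w = y)).2
      ⟨x, by simp only at hx; rw [hx]; simp⟩
    exact this

lemma bijective_mulOperator (hg : AEMeasurable g μ) {ε : ℝ} (hε : 0 < ε)
    (h : ∀ᵐ x ∂μ, ε ≤ ‖g x‖) :
    Function.Bijective fun x : (mulOperator μ g).domain => mulOperator μ g x := by
  constructor
  · intro u v huv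
    have h1 := norm_le_mulOperator_sub_smul (z := 0) hε (by simpa using h) (u - v)
    simp only at huv
    rw [LinearPMap.map_sub, huv] at h1
    simp only [sub_self, zero_smul, norm_zero, mul_zero] at h1
    exact sub_eq_zero.1 (Subtype.ext (norm_le_zero_iff.1 h1))
  · intro v
    -- The preimage of `v` is `g⁻¹ v`.
    have hmem : MemLp (fun x => (g x)⁻¹ * v x) 2 μ := by
      refine (Lp.memLp v).of_le_mul (c := ε⁻¹) (hg.inv.aestronglyMeasurable.mul
        (Lp.aestronglyMeasurable v)) ?_
      filter_upwards [h] with x hx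
      rw [norm_mul, norm_inv]
      gcongr
    have hprod : (fun x => g x * hmem.toLp _ x) =ᵐ[μ] v := by
      filter_upwards [h, hmem.coeFn_toLp] with x hx h1
      rw [h1, mul_inv_cancel_left₀]
      exact norm_pos_iff.1 (hε.trans_le hx)
    refine ⟨⟨hmem.toLp _, (Lp.memLp v).ae_eq hprod.symm⟩, ?_⟩
    exact Lp.ext ((coeFn_mulOperator _).trans hprod)

lemma IsInvertible.not_isApproxEigenvalue {A : H →ₗ.[ℂ] H} (hA : IsInvertible A) :
    ¬ IsApproxEigenvalue A 0 := by
  intro h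
  obtain ⟨-, C, hC⟩ := hA
  -- Chosen so that `|C| * (|C| + 1)⁻¹ < 1`, whatever the sign of `C`.
  obtain ⟨u, hu0, hu⟩ := h (|C| + 1)⁻¹ (by positivity)
  rw [zero_smul, sub_zero] at hu
  have hpos : 0 < ‖(u : H)‖ := norm_pos_iff.2 hu0
  have h1 : ‖(u : H)‖ ≤ |C| * ((|C| + 1)⁻¹ * ‖(u : H)‖) :=
    (hC u).trans (mul_le_mul (le_abs_self C) hu (norm_nonneg _) (abs_nonneg _))
  have h2 : |C| * ((|C| + 1)⁻¹ * ‖(u : H)‖) < ‖(u : H)‖ := by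
    rw [← mul_assoc, ← div_eq_mul_inv]
    exact mul_lt_of_lt_one_left hpos ((div_lt_one (by positivity)).2 (by linarith))
  linarith

/-- A function of a normal operator is invertible iff it is essentially bounded away from `0`. -/
lemma SpectralRepresentation.isInvertible_iff {A : H →ₗ.[ℂ] H} (R : SpectralRepresentation A) :
    IsInvertible A ↔ ∃ ε : ℝ, 0 < ε ∧ ∀ᵐ x ∂(R.μ), ε ≤ ‖R.g x‖ := by
  constructor
  · intro h
    have h1 := h.not_isApproxEigenvalue
    rw [R.isApproxEigenvalue_iff, notMem_support_map_iff R.aemeasurable_g] at h1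
    simpa using h1
  · rintro ⟨ε, hε, h⟩
    rw [R.eq_conj]
    refine ⟨bijective_unitaryConj R.U _ (bijective_mulOperator R.aemeasurable_g hε h), ε⁻¹,
      fun x => ?_⟩
    have h1 := norm_le_mulOperator_sub_smul (z := 0) hε (by simpa using h)
      (⟨R.U x, x.2⟩ : (mulOperator R.μ R.g).domain)
    rw [unitaryConj_apply, LinearIsometryEquiv.norm_map]
    simpa using h1

end General

/-! ### Absolutely continuous functions and weak derivatives -/

section WeakDerivative

open scoped ContDiff
open Set Filter Topology

/-- Comparison principle, applied to real and imaginary parts, to primitives of `k` against those of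
`‖k‖`, and to translates by a constant. -/
lemma absolutelyContinuousOnInterval_of_dist_le {E E' : Type*} [PseudoMetricSpace E]
    [PseudoMetricSpace E'] {F : ℝ → E} {G : ℝ → E'} {a b : ℝ}
    (hG : AbsolutelyContinuousOnInterval G a b)
    (h : ∀ x ∈ uIcc a b, ∀ y ∈ uIcc a b, dist (F x) (F y) ≤ dist (G x) (G y)) :
    AbsolutelyContinuousOnInterval F a b := by
  rw [absolutelyContinuousOnInterval_iff] at hG ⊢
  intro ε hε
  obtain ⟨δ, hδ, H⟩ := hG ε hε
  refine ⟨δ, hδ, fun I hI hlt => (Finset.sum_le_sum fun i hi => ?_).trans_lt (H I hI hlt)⟩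
  exact h _ (hI.1 i hi).1 _ (hI.1 i hi).2

lemma LocallyAbsCont.re {F : ℝ → ℂ} (hF : LocallyAbsCont F) (a b : ℝ) :
    AbsolutelyContinuousOnInterval (fun t => (F t).re) a b :=
  absolutelyContinuousOnInterval_of_dist_le (hF a b) fun x _ y _ => by
    rw [Real.dist_eq, ← Complex.sub_re, dist_eq_norm]
    exact Complex.abs_re_le_norm _

lemma LocallyAbsCont.im {F : ℝ → ℂ} (hF : LocallyAbsCont F) (a b : ℝ) :
    AbsolutelyContinuousOnInterval (fun t => (F t).im) a b :=
  absolutelyContinuousOnInterval_of_dist_le (hF a b) fun x _ y _ => by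
    rw [Real.dist_eq, ← Complex.sub_im, dist_eq_norm]
    exact Complex.abs_im_le_norm _

lemma LocallyAbsCont.ae_deriv_eq {F : ℝ → ℂ} (hF : LocallyAbsCont F) :
    deriv F =ᵐ[volume] fun t => ((deriv (fun s => (F s).re) t : ℝ) : ℂ) +
      ((deriv (fun s => (F s).im) t : ℝ) : ℂ) * Complex.I := by
  filter_upwards [hF.ae_differentiableAt] with t ht
  have hre : HasDerivAt (fun s => (F s).re) (deriv F t).re t :=
    (Complex.reCLM.hasFDerivAt.comp_hasDerivAt t ht.hasDerivAt)
  have him : HasDerivAt (fun s => (F s).im) (deriv F t).im t :=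
    (Complex.imCLM.hasFDerivAt.comp_hasDerivAt t ht.hasDerivAt)
  rw [hre.deriv, him.deriv, Complex.re_add_im]

lemma intervalIntegrable_ofReal {f : ℝ → ℝ} {a b : ℝ} (hf : IntervalIntegrable f volume a b) :
    IntervalIntegrable (fun t => (f t : ℂ)) volume a b :=
  ⟨hf.1.ofReal, hf.2.ofReal⟩

lemma LocallyAbsCont.intervalIntegrable_deriv {F : ℝ → ℂ} (hF : LocallyAbsCont F) (a b : ℝ) :
    IntervalIntegrable (deriv F) volume a b := by
  have h := intervalIntegrable_ofReal (hF.re a b).intervalIntegrable_deriv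
  have h' := intervalIntegrable_ofReal (hF.im a b).intervalIntegrable_deriv
  exact (h.add (h'.mul_const Complex.I)).congr_ae (ae_restrict_of_ae hF.ae_deriv_eq.symm)

lemma LocallyAbsCont.integral_deriv_eq_sub {F : ℝ → ℂ} (hF : LocallyAbsCont F) (a b : ℝ) :
    ∫ t in a..b, deriv F t = F b - F a := by
  have h := intervalIntegrable_ofReal (hF.re a b).intervalIntegrable_deriv
  have h' := intervalIntegrable_ofReal (hF.im a b).intervalIntegrable_deriv
  rw [intervalIntegral.integral_congr_ae (hF.ae_deriv_eq.mono fun t ht _ => ht),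
    intervalIntegral.integral_add h (h'.mul_const Complex.I),
    intervalIntegral.integral_mul_const, intervalIntegral.integral_ofReal,
    intervalIntegral.integral_ofReal, (hF.re a b).integral_deriv_eq_sub,
    (hF.im a b).integral_deriv_eq_sub]
  apply Complex.ext <;> simp

lemma locallyIntegrable_of_intervalIntegrable {k : ℝ → ℂ}
    (h : ∀ a b, IntervalIntegrable k volume a b) : LocallyIntegrable k := by
  rw [locallyIntegrable_iff]
  intro K hK
  obtain ⟨R, hR⟩ := hK.isBounded.subset_closedBall 0
  rw [Real.closedBall_eq_Icc] at hR
  rcases le_or_gt (0 - R) (0 + R) with h0 | h0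
  · exact ((intervalIntegrable_iff_integrableOn_Icc_of_le h0).1 (h _ _)).mono_set hR
  · rw [Icc_eq_empty (not_le.2 h0)] at hR
    simp [subset_empty_iff.1 hR]

lemma LocallyAbsCont.locallyIntegrable_deriv {F : ℝ → ℂ} (hF : LocallyAbsCont F) :
    LocallyIntegrable (deriv F) :=
  locallyIntegrable_of_intervalIntegrable hF.intervalIntegrable_deriv

lemma intervalIntegrable_of_locallyIntegrable {k : ℝ → ℂ} (hk : LocallyIntegrable k) (a b : ℝ) :
    IntervalIntegrable k volume a b :=
  intervalIntegrable_iff.2 ((hk.integrableOn_isCompact isCompact_uIcc).mono_set uIoc_subset_uIcc)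

lemma locallyAbsCont_intervalIntegral {k : ℝ → ℂ} (hk : LocallyIntegrable k) :
    LocallyAbsCont fun x => ∫ t in (0 : ℝ)..x, k t := by
  intro a b
  have hi := intervalIntegrable_of_locallyIntegrable hk
  have hn : ∀ a b, IntervalIntegrable (fun t => ‖k t‖) volume a b := fun a b => (hi a b).norm
  refine absolutelyContinuousOnInterval_of_dist_le
    ((hn a b).absolutelyContinuousOnInterval_intervalIntegral left_mem_uIcc) fun x _ y _ => ?_
  rw [dist_eq_norm, dist_eq_norm, intervalIntegral.integral_interval_sub_left (hi _ _) (hi _ _),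
    intervalIntegral.integral_interval_sub_left (hn _ _) (hn _ _), Real.norm_eq_abs]
  exact intervalIntegral.norm_integral_le_abs_integral_norm

/-- `k` is the weak derivative of `f` on the real line. -/
def HasWeakDeriv (f k : ℝ → ℂ) : Prop :=
  ∀ χ : ℝ → ℂ, ContDiff ℝ ∞ χ → HasCompactSupport χ →
    ∫ t, deriv χ t * f t = -∫ t, χ t * k t

lemma HasWeakDeriv.congr_ae {f f' k k' : ℝ → ℂ} (h : HasWeakDeriv f k)
    (hf : f =ᵐ[volume] f') (hk : k =ᵐ[volume] k') : HasWeakDeriv f' k' := by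
  intro χ hχ hc
  rw [← integral_congr_ae (hf.mono fun t ht => by simp only [ht] :
      (fun t => deriv χ t * f t) =ᵐ[volume] fun t => deriv χ t * f' t),
    ← integral_congr_ae (hk.mono fun t ht => by simp only [ht] :
      (fun t => χ t * k t) =ᵐ[volume] fun t => χ t * k' t)]
  exact h χ hχ hc

lemma integrable_mul_of_hasCompactSupport {f χ : ℝ → ℂ} (hf : LocallyIntegrable f)
    (hχ : Continuous χ) (hc : HasCompactSupport χ) : Integrable fun t => χ t * f t :=
  hf.integrable_smul_left_of_hasCompactSupport hχ hc

lemma LocallyAbsCont.mul {F G : ℝ → ℂ} (hF : LocallyAbsCont F) (hG : LocallyAbsCont G) :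
    LocallyAbsCont fun t => F t * G t :=
  fun a b => (hF a b).fun_smul (hG a b)

lemma locallyAbsCont_of_contDiff {χ : ℝ → ℂ} (hχ : ContDiff ℝ ∞ χ) : LocallyAbsCont χ :=
  fun _ _ => (hχ.of_le (by simp)).contDiffOn.absolutelyContinuousOnInterval

/-- A compactly supported absolutely continuous function has a derivative of mean zero. -/
lemma LocallyAbsCont.integral_deriv_eq_zero {F : ℝ → ℂ} (hF : LocallyAbsCont F)
    (hc : HasCompactSupport F) : ∫ t, deriv F t = 0 := by
  obtain ⟨R, hR⟩ := hc.isCompact.isBounded.subset_closedBall 0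
  rw [Real.closedBall_eq_Icc, zero_sub, zero_add] at hR
  have h0 : ∀ t, t ∉ Icc (-R) R → F t = 0 := fun t ht =>
    image_eq_zero_of_notMem_tsupport fun h => ht (hR h)
  rw [← intervalIntegral.integral_eq_integral_of_support_subset (a := -R - 1) (b := R + 1),
    hF.integral_deriv_eq_sub, h0 (-R - 1), h0 (R + 1), sub_zero]
  · simp
  · simp
  · exact (support_deriv_subset.trans hR).trans fun t ht => ⟨by linarith [ht.1], by linarith [ht.2]⟩

/-- Integration by parts: `χ F` is absolutely continuous with compact support, so its derivative has
mean zero. -/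
lemma LocallyAbsCont.hasWeakDeriv {F : ℝ → ℂ} (hF : LocallyAbsCont F) :
    HasWeakDeriv F (deriv F) := by
  intro χ hχ hc
  have h1 := (locallyAbsCont_of_contDiff hχ).mul hF
  have h2 := h1.integral_deriv_eq_zero hc.mul_right
  have h3 : deriv (fun t => χ t * F t) =ᵐ[volume] fun t => deriv χ t * F t + χ t * deriv F t := by
    filter_upwards [hF.ae_differentiableAt] with t ht
    exact ((hχ.differentiable (by simp) t).hasDerivAt.mul ht.hasDerivAt).deriv
  rw [integral_congr_ae h3, integral_add] at h2
  · exact eq_neg_of_add_eq_zero_left h2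
  · exact integrable_mul_of_hasCompactSupport hF.continuous.locallyIntegrable
      (hχ.continuous_deriv (by simp)) hc.deriv
  · exact integrable_mul_of_hasCompactSupport hF.locallyIntegrable_deriv hχ.continuous hc

/-- A smooth compactly supported function of mean zero has a smooth compactly supported
primitive. -/
lemma exists_primitive_of_integral_eq_zero {θ : ℝ → ℂ} (hθ : ContDiff ℝ ∞ θ)
    (hc : HasCompactSupport θ) (h0 : ∫ t, θ t = 0) :
    ∃ χ : ℝ → ℂ, ContDiff ℝ ∞ χ ∧ HasCompactSupport χ ∧ deriv χ = θ := by
  obtain ⟨R, hR⟩ := hc.isCompact.isBounded.subset_closedBall 0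
  rw [Real.closedBall_eq_Icc, zero_sub, zero_add] at hR
  have hz : ∀ t, t ∉ Icc (-R) R → θ t = 0 := fun t ht =>
    image_eq_zero_of_notMem_tsupport fun h => ht (hR h)
  -- The base point lies strictly left of the support because interval integrals run over half-open
  -- intervals. Beyond `R` the primitive equals the full integral, which is `0`.
  let χ : ℝ → ℂ := fun x => ∫ t in (-R - 1)..x, θ t
  have hd : ∀ x, HasDerivAt χ (θ x) x := fun x =>
    intervalIntegral.integral_hasDerivAt_right (hθ.continuous.intervalIntegrable _ _)
      (hθ.continuous.stronglyMeasurableAtFilter _ _) hθ.continuous.continuousAt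
  have hderiv : deriv χ = θ := funext fun x => (hd x).deriv
  refine ⟨χ, ?_, ?_, hderiv⟩
  · rw [contDiff_infty_iff_deriv, hderiv]
    exact ⟨fun x => (hd x).differentiableAt, hθ⟩
  · refine HasCompactSupport.intro (isCompact_Icc (a := -R - 1) (b := R)) fun x hx => ?_
    rcases lt_or_ge x (-R - 1) with hlt | hge
    · refine (intervalIntegral.integral_congr (g := fun _ => 0) fun t ht => hz t fun h => ?_).trans
        (by simp)
      rw [uIcc_of_ge hlt.le] at ht
      linarith [h.1, ht.2]
    · have hxR : R < x := not_le.1 fun h => hx ⟨hge, h⟩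
      change ∫ t in (-R - 1)..x, θ t = 0
      rw [intervalIntegral.integral_eq_integral_of_support_subset, h0]
      intro t ht
      have := hR (subset_tsupport _ ht)
      exact ⟨by linarith [this.1], by linarith [this.2]⟩

/-- The du Bois-Reymond lemma. -/
lemma ae_eq_const_of_hasWeakDeriv_zero {u : ℝ → ℂ} (hu : LocallyIntegrable u)
    (h : HasWeakDeriv u 0) : ∃ C : ℂ, u =ᵐ[volume] fun _ => C := by
  let b : ContDiffBump (0 : ℝ) := ⟨1, 2, one_pos, one_lt_two⟩
  let ρ : ℝ → ℂ := fun t => ((b.normed volume t : ℝ) : ℂ)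
  have hρ : ContDiff ℝ ∞ ρ := Complex.ofRealCLM.contDiff.comp b.contDiff_normed
  have hρc : HasCompactSupport ρ := b.hasCompactSupport_normed.comp_left (g := Complex.ofReal) rfl
  have hρ1 : ∫ t, ρ t = 1 := by
    rw [integral_complex_ofReal, b.integral_normed, Complex.ofReal_one]
  let C : ℂ := ∫ t, ρ t * u t
  refine ⟨C, ae_eq_of_integral_contDiff_smul_eq hu continuous_const.locallyIntegrable
    fun γ hγ hγc => ?_⟩
  let γ' : ℝ → ℂ := fun t => (γ t : ℂ)
  have hγ' : ContDiff ℝ ∞ γ' := Complex.ofRealCLM.contDiff.comp hγ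
  have hγc' : HasCompactSupport γ' := hγc.comp_left (g := Complex.ofReal) rfl
  let m : ℂ := ∫ t, γ' t
  -- Subtracting `m ρ`, where `ρ` has integral `1`, makes the mean vanish. Testing `u` against the
  -- resulting primitive gives `∫ γ u = m C`.
  have hθ : ContDiff ℝ ∞ fun t => γ' t - m * ρ t := hγ'.sub (contDiff_const.mul hρ)
  have hθc : HasCompactSupport fun t => γ' t - m * ρ t := hγc'.sub hρc.mul_left
  have hi := hγ'.continuous.integrable_of_hasCompactSupport (μ := volume) hγc'
  have hi' := hρ.continuous.integrable_of_hasCompactSupport (μ := volume) hρc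
  obtain ⟨χ, hχ, hχc, hχd⟩ := exists_primitive_of_integral_eq_zero hθ hθc (by
    rw [integral_sub hi (hi'.const_mul m), integral_const_mul, hρ1, mul_one, sub_self])
  have h1 := h χ hχ hχc
  have e : ∀ t, (γ' t - m * ρ t) * u t = γ' t * u t - m * (ρ t * u t) := fun t => by ring
  simp only [hχd, Pi.zero_apply, mul_zero, integral_zero, neg_zero, e] at h1
  rw [integral_sub (integrable_mul_of_hasCompactSupport hu hγ'.continuous hγc')
    ((integrable_mul_of_hasCompactSupport hu hρ.continuous hρc).const_mul m),
    integral_const_mul, sub_eq_zero] at h1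
  simp only [Complex.real_smul]
  rw [integral_mul_const]
  exact h1

/-- A function with a locally integrable weak derivative is, almost everywhere, locally absolutely
continuous. -/
lemma HasWeakDeriv.exists_locallyAbsCont {f k : ℝ → ℂ} (hf : LocallyIntegrable f)
    (hk : LocallyIntegrable k) (h : HasWeakDeriv f k) :
    ∃ F : ℝ → ℂ, LocallyAbsCont F ∧ f =ᵐ[volume] F ∧ deriv F =ᵐ[volume] k := by
  let G : ℝ → ℂ := fun x => ∫ t in (0 : ℝ)..x, k t
  have hG : LocallyAbsCont G := locallyAbsCont_intervalIntegral hk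
  have hGd : ∀ᵐ x, HasDerivAt G (k x) x :=
    (_root_.LocallyIntegrable.ae_hasDerivAt_integral hk).mono fun x hx => hx 0
  have hGw : HasWeakDeriv G k := hG.hasWeakDeriv.congr_ae .rfl (hGd.mono fun x hx => hx.deriv)
  have hGi : LocallyIntegrable G := hG.continuous.locallyIntegrable
  -- `f` and the primitive `G` of `k` have the same weak derivative, so they differ by a constant.
  obtain ⟨C, hC⟩ := ae_eq_const_of_hasWeakDeriv_zero (hf.sub hGi) (fun χ hχ hc => by
    have hd : Continuous (deriv χ) := hχ.continuous_deriv (by simp)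
    simp only [Pi.sub_apply, mul_sub, Pi.zero_apply, mul_zero, integral_zero, neg_zero]
    rw [integral_sub (integrable_mul_of_hasCompactSupport hf hd hc.deriv)
      (integrable_mul_of_hasCompactSupport hGi hd hc.deriv), h χ hχ hc, hGw χ hχ hc, sub_self])
  refine ⟨fun t => G t + C, fun a b => absolutelyContinuousOnInterval_of_dist_le (hG a b)
    fun x _ y _ => by simp, ?_, ?_⟩
  · filter_upwards [hC] with t ht
    rw [← ht, Pi.sub_apply]
    ring
  · filter_upwards [hGd] with t ht
    exact (ht.add_const C).deriv

end WeakDerivative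

/-! ### Weak derivatives under the Fourier transform -/

section Fourier

open scoped ContDiff SchwartzMap FourierTransform LineDeriv
open Set Filter Topology

lemma integrable_schwartz_mul (ψ : 𝓢(ℝ, ℂ)) (f : Lp ℂ 2 (volume : Measure ℝ)) :
    Integrable fun t => ψ t * f t :=
  (ψ.memLp 2 volume).integrable_mul (Lp.memLp f)

lemma deriv_comp_div_const (β : ℝ → ℂ) (R t : ℝ) :
    deriv (fun s => β (s / R)) t = R⁻¹ • deriv β (t / R) := by
  simpa [div_eq_inv_mul] using deriv_comp_mul_left R⁻¹ β t

/-- A weak derivative of a square integrable function can be tested against Schwartz functions. -/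
lemma HasWeakDeriv.integral_schwartz {f k : Lp ℂ 2 (volume : Measure ℝ)} (h : HasWeakDeriv f k)
    (ψ : 𝓢(ℝ, ℂ)) : ∫ t, deriv ψ t * f t = -∫ t, ψ t * k t := by
  let b : ContDiffBump (0 : ℝ) := ⟨1, 2, one_pos, one_lt_two⟩
  let β : ℝ → ℂ := fun t => (b t : ℂ)
  have hβ : ContDiff ℝ ∞ β := Complex.ofRealCLM.contDiff.comp b.contDiff
  have hβc : HasCompactSupport β := b.hasCompactSupport.comp_left (g := Complex.ofReal) rfl
  have hβ1 : ∀ t, ‖β t‖ ≤ 1 := fun t => by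
    simp only [β, Complex.norm_real, Real.norm_eq_abs, abs_of_nonneg b.nonneg]
    exact b.le_one
  obtain ⟨C, hC⟩ := (hβ.continuous_deriv (by simp)).bounded_above_of_compact_support hβc.deriv
  have hC0 : 0 ≤ C := (norm_nonneg _).trans (hC 0)
  -- The cut-offs `β (t / r n)` exhaust the line. Since `r n ≥ 1`, their derivatives are bounded by
  -- `C` uniformly in `n`, and they tend to `0`.
  let r : ℕ → ℝ := fun n => (n : ℝ) + 1
  have hr : ∀ n, 1 ≤ r n := fun n => by simp [r]
  have hr0 : ∀ n, r n ≠ 0 := fun n => (zero_lt_one.trans_le (hr n)).ne'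
  have hrtop : Tendsto r atTop atTop := tendsto_atTop_add_const_right _ _ tendsto_natCast_atTop_atTop
  have hrinv : Tendsto (fun n => (r n)⁻¹) atTop (𝓝 0) := tendsto_inv_atTop_zero.comp hrtop
  let χ : ℕ → ℝ → ℂ := fun n t => β (t / r n)
  have hχ : ∀ n, ContDiff ℝ ∞ (χ n) := fun n => hβ.comp (contDiff_id.div_const _)
  have hχc : ∀ n, HasCompactSupport (χ n) := fun n => by
    have := hβc.comp_homeomorph (Homeomorph.mulRight₀ (r n)⁻¹ (inv_ne_zero (hr0 n)))
    simpa [χ, div_eq_mul_inv, Function.comp_def] using this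
  have hψ : ContDiff ℝ ∞ ψ := ψ.smooth ⊤
  have hderiv : ∀ n t, deriv (fun s => χ n s * ψ s) t =
      (r n)⁻¹ • deriv β (t / r n) * ψ t + β (t / r n) * deriv ψ t := fun n t => by
    rw [← deriv_comp_div_const]
    exact (((hχ n).differentiable (by simp) t).hasDerivAt.mul
      (hψ.differentiable (by simp) t).hasDerivAt).deriv
  have key : ∀ n, ∫ t, deriv (fun s => χ n s * ψ s) t * f t = -∫ t, (χ n t * ψ t) * k t :=
    fun n => h _ ((hχ n).mul hψ) (hχc n).mul_right
  have hone : ∀ t, Tendsto (fun n => β (t / r n)) atTop (𝓝 1) := fun t => by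
    have h0 : Tendsto (fun n => t / r n) atTop (𝓝 0) := by
      simpa [div_eq_mul_inv] using hrinv.const_mul t
    have := (hβ.continuous.tendsto 0).comp h0
    have hb : b 0 = 1 := b.one_of_mem_closedBall (by simp [b])
    simpa [β, hb, Function.comp_def] using this
  have lim1 : Tendsto (fun n => ∫ t, deriv (fun s => χ n s * ψ s) t * f t) atTop
      (𝓝 (∫ t, deriv ψ t * f t)) := by
    refine tendsto_integral_of_dominated_convergence
      (fun t => C * ‖ψ t * f t‖ + ‖deriv ψ t * f t‖) (fun n => ?_) ?_ (fun n => ?_) ?_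
    · exact ((((hχ n).mul hψ).continuous_deriv (by simp)).aestronglyMeasurable).mul
        (Lp.aestronglyMeasurable f)
    · exact ((integrable_schwartz_mul ψ f).norm.const_mul C).add
        (integrable_schwartz_mul (SchwartzMap.derivCLM ℂ ℂ ψ) f).norm
    · refine .of_forall fun t => ?_
      rw [hderiv, add_mul, mul_assoc, mul_assoc]
      refine (norm_add_le _ _).trans (add_le_add ?_ ?_)
      · rw [norm_mul, norm_smul, norm_inv, Real.norm_eq_abs]
        refine mul_le_mul_of_nonneg_right ?_ (norm_nonneg _)
        refine (mul_le_mul (inv_le_one_of_one_le₀ ((hr n).trans (le_abs_self _))) (hC _)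
          (norm_nonneg _) zero_le_one).trans_eq (one_mul C)
      · rw [norm_mul]
        exact mul_le_of_le_one_left (norm_nonneg _) (hβ1 _)
    · refine .of_forall fun t => ?_
      have h1 : Tendsto (fun n => (r n)⁻¹ • deriv β (t / r n)) atTop (𝓝 0) := by
        refine squeeze_zero_norm (a := fun n => (r n)⁻¹ * C) (fun n => ?_)
          (by simpa using hrinv.mul_const C)
        rw [norm_smul, Real.norm_of_nonneg (inv_nonneg.2 (zero_le_one.trans (hr n)))]
        exact mul_le_mul_of_nonneg_left (hC _) (inv_nonneg.2 (zero_le_one.trans (hr n)))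
      have h2 := ((h1.mul_const (ψ t)).add ((hone t).mul_const (deriv ψ t))).mul_const (f t)
      simpa only [hderiv, zero_mul, zero_add, one_mul] using h2
  have lim2 : Tendsto (fun n => ∫ t, (χ n t * ψ t) * k t) atTop (𝓝 (∫ t, ψ t * k t)) := by
    refine tendsto_integral_of_dominated_convergence (fun t => ‖ψ t * k t‖) (fun n => ?_)
      (integrable_schwartz_mul ψ k).norm (fun n => .of_forall fun t => ?_) (.of_forall fun t => ?_)
    · exact (((hχ n).mul hψ).continuous.aestronglyMeasurable).mul (Lp.aestronglyMeasurable k)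
    · rw [mul_assoc, norm_mul]
      exact mul_le_of_le_one_left (norm_nonneg _) (hβ1 _)
    · simpa using ((hone t).mul_const (ψ t)).mul_const (k t)
  exact tendsto_nhds_unique lim1 (by simpa only [key] using lim2.neg)

lemma lineDerivOp_toTemperedDistribution_apply (f : Lp ℂ 2 (volume : Measure ℝ)) (ψ : 𝓢(ℝ, ℂ)) :
    (∂_{(1 : ℝ)} (f : 𝓢'(ℝ, ℂ))) ψ = -∫ t, deriv ψ t * f t := by
  rw [TemperedDistribution.lineDerivOp_apply_apply, map_neg, Lp.toTemperedDistribution_apply]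
  congr 1

/-- The two sides differ only in the test functions, compactly supported against Schwartz.
`HasWeakDeriv.integral_schwartz` bridges the gap. -/
lemma hasWeakDeriv_iff_lineDerivOp_eq {f k : Lp ℂ 2 (volume : Measure ℝ)} :
    HasWeakDeriv f k ↔ ∂_{(1 : ℝ)} (f : 𝓢'(ℝ, ℂ)) = (k : 𝓢'(ℝ, ℂ)) := by
  constructor
  · intro h
    ext ψ
    rw [lineDerivOp_toTemperedDistribution_apply, h.integral_schwartz,
      Lp.toTemperedDistribution_apply, neg_neg]
    simp
  · intro h χ hχ hc
    have h1 := lineDerivOp_toTemperedDistribution_apply f (hc.toSchwartzMap hχ)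
    rw [h, Lp.toTemperedDistribution_apply] at h1
    exact (neg_eq_iff_eq_neg.1 h1.symm)

/-- The Fourier transform turns the weak derivative into multiplication by `2 π i ξ`. -/
lemma hasWeakDeriv_iff_fourier {f k : Lp ℂ 2 (volume : Measure ℝ)} :
    HasWeakDeriv f k ↔
      (𝓕 k : Lp ℂ 2 (volume : Measure ℝ)) =ᵐ[volume]
        fun ξ => 2 * Real.pi * Complex.I * ξ * (𝓕 f : Lp ℂ 2 (volume : Measure ℝ)) ξ := by
  have hg : (fun ξ : ℝ => inner ℝ ξ (1 : ℝ)).HasTemperateGrowth := by fun_prop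
  have happ : ∀ ψ : 𝓢(ℝ, ℂ), (𝓕 (∂_{(1 : ℝ)} (f : 𝓢'(ℝ, ℂ)))) ψ =
      ∫ ξ, ψ ξ * (2 * Real.pi * Complex.I * ξ * (𝓕 f : Lp ℂ 2 (volume : Measure ℝ)) ξ) := by
    intro ψ
    rw [TemperedDistribution.fourier_lineDerivOp_eq, Lp.fourier_toTemperedDistribution_eq]
    change (2 * Real.pi * Complex.I) • (TemperedDistribution.smulLeftCLM ℂ _ _) ψ = _
    rw [TemperedDistribution.smulLeftCLM_apply_apply, Lp.toTemperedDistribution_apply,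
      ← integral_smul]
    refine integral_congr_ae (.of_forall fun ξ => ?_)
    simp only
    rw [SchwartzMap.smulLeftCLM_apply_apply (by fun_prop)]
    simp
    ring
  rw [hasWeakDeriv_iff_lineDerivOp_eq]
  constructor
  · intro h
    have hk : LocallyIntegrable (𝓕 k : Lp ℂ 2 (volume : Measure ℝ)) :=
      (Lp.memLp _).locallyIntegrable one_le_two
    have hf : LocallyIntegrable
        (fun ξ : ℝ => 2 * Real.pi * Complex.I * ξ * (𝓕 f : Lp ℂ 2 (volume : Measure ℝ)) ξ) := by
      have h1 : LocallyIntegrable (𝓕 f : Lp ℂ 2 (volume : Measure ℝ)) :=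
        (Lp.memLp _).locallyIntegrable one_le_two
      rw [← locallyIntegrableOn_univ] at h1 ⊢
      exact h1.continuousOn_mul (by fun_prop) isOpen_univ.isLocallyClosed
    refine ae_eq_of_integral_contDiff_smul_eq hk hf fun γ hγ hγc => ?_
    have hγc' : HasCompactSupport fun t => (γ t : ℂ) := hγc.comp_left (g := Complex.ofReal) rfl
    have h1 := happ (hγc'.toSchwartzMap (Complex.ofRealCLM.contDiff.comp hγ))
    rw [h, Lp.fourier_toTemperedDistribution_eq, Lp.toTemperedDistribution_apply] at h1
    simp only [Complex.real_smul]
    exact h1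
  · intro h
    have h1 : 𝓕 (∂_{(1 : ℝ)} (f : 𝓢'(ℝ, ℂ))) = 𝓕 (k : 𝓢'(ℝ, ℂ)) := by
      ext ψ
      rw [happ, Lp.fourier_toTemperedDistribution_eq, Lp.toTemperedDistribution_apply]
      refine integral_congr_ae ?_
      filter_upwards [h] with ξ hξ
      rw [hξ, smul_eq_mul]
    -- The Fourier transform is injective on tempered distributions.
    have h2 := congrArg 𝓕⁻ h1
    rwa [FourierTransform.fourierInv_fourier_eq, FourierTransform.fourierInv_fourier_eq] at h2

end Fourier

/-! ### Graphs of conjugated and multiplication operators -/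

section Graph

variable {X : Type*} [MeasurableSpace X]
variable {H K : Type*} [NormedAddCommGroup H] [InnerProductSpace ℂ H]
  [NormedAddCommGroup K] [InnerProductSpace ℂ K]

lemma mem_graph_unitaryConj_iff (U : H ≃ₗᵢ[ℂ] K) (B : K →ₗ.[ℂ] K) {x y : H} :
    (x, y) ∈ (unitaryConj U B).graph ↔ (U x, U y) ∈ B.graph := by
  simp only [LinearPMap.mem_graph_iff]
  constructor
  · rintro ⟨u, rfl, hu⟩
    exact ⟨⟨U u, u.2⟩, rfl, by rw [← hu, unitaryConj_apply, U.apply_symm_apply]⟩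
  · rintro ⟨v, hv, hy⟩
    refine ⟨⟨x, show U x ∈ B.domain from hv ▸ v.2⟩, rfl, ?_⟩
    rw [unitaryConj_apply, ← U.symm_apply_apply y]
    have hv' : (⟨U x, hv ▸ v.2⟩ : B.domain) = v := Subtype.ext hv.symm
    rw [hv', hy]

lemma mem_graph_mulOperator_iff {μ : Measure X} {g : X → ℂ} {u v : Lp ℂ 2 μ} :
    (u, v) ∈ (mulOperator μ g).graph ↔ v =ᵐ[μ] fun x => g x * u x := by
  simp only [LinearPMap.mem_graph_iff]
  constructor
  · rintro ⟨w, rfl, rfl⟩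
    exact coeFn_mulOperator w
  · intro h
    refine ⟨⟨u, (Lp.memLp v).ae_eq h⟩, rfl, Lp.ext ((coeFn_mulOperator _).trans h.symm)⟩

end Graph

/-! ### Removing the weight and diagonalising the shift -/

section Weight

open scoped ContDiff FourierTransform

lemma ae_weight_iff (c : ℝ) {p : ℝ → Prop} : (∀ᵐ t ∂(weight c), p t) ↔ ∀ᵐ t, p t :=
  ⟨fun h => (absolutelyContinuous_weight c).ae_le h,
    fun h => (weight_absolutelyContinuous c).ae_le h⟩

lemma aestronglyMeasurable_weight_iff (c : ℝ) {f : ℝ → ℂ} :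
    AEStronglyMeasurable f (weight c) ↔ AEStronglyMeasurable f volume :=
  ⟨fun h => h.mono_ac (absolutelyContinuous_weight c),
    fun h => h.mono_ac (weight_absolutelyContinuous c)⟩

/-- The function `e^{at}`, with complex values. -/
def expMul (a : ℝ) (t : ℝ) : ℂ := (Real.exp (a * t) : ℂ)

lemma contDiff_expMul (a : ℝ) : ContDiff ℝ ∞ (expMul a) :=
  Complex.ofRealCLM.contDiff.comp (Real.contDiff_exp.comp (contDiff_const.mul contDiff_id))

lemma continuous_expMul (a : ℝ) : Continuous (expMul a) := (contDiff_expMul a).continuous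

lemma hasDerivAt_expMul (a t : ℝ) : HasDerivAt (expMul a) (a * expMul a t) t := by
  have h : HasDerivAt (fun t => Real.exp (a * t)) (Real.exp (a * t) * (a * 1)) t :=
    ((hasDerivAt_id t).const_mul a).exp
  have h' := h.ofReal_comp
  refine h'.congr_deriv ?_
  rw [mul_one, mul_comm, Complex.ofReal_mul]
  rfl

lemma expMul_mul_expMul_neg (a t : ℝ) : expMul a t * expMul (-a) t = 1 := by
  rw [expMul, expMul, ← Complex.ofReal_mul, ← Real.exp_add]
  simp

lemma expMul_neg_mul_expMul (a t : ℝ) : expMul (-a) t * expMul a t = 1 := by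
  rw [mul_comm, expMul_mul_expMul_neg]

lemma eLpNorm_expMul_mul (c : ℝ) (f : ℝ → ℂ) :
    eLpNorm (fun t => expMul (-c) t * f t) 2 volume = eLpNorm f 2 (weight c) := by
  rw [eLpNorm_eq_lintegral_rpow_enorm_toReal two_ne_zero ENNReal.ofNat_ne_top,
    eLpNorm_eq_lintegral_rpow_enorm_toReal two_ne_zero ENNReal.ofNat_ne_top, weight,
    lintegral_withDensity_eq_lintegral_mul_non_measurable _ (by fun_prop)
      (.of_forall fun t => by simp)]
  congr 1
  refine lintegral_congr fun t => ?_
  simp only [Pi.mul_apply, ENNReal.toReal_ofNat, ENNReal.rpow_ofNat, enorm_mul, mul_pow]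
  congr 1
  rw [expMul, ← ofReal_norm, Complex.norm_real, Real.norm_of_nonneg (Real.exp_pos _).le,
    ← ENNReal.ofReal_pow (Real.exp_pos _).le, ← Real.exp_nat_mul]
  congr 2
  push_cast
  ring

lemma memLp_expMul_mul_iff (c : ℝ) {f : ℝ → ℂ} :
    MemLp (fun t => expMul (-c) t * f t) 2 volume ↔ MemLp f 2 (weight c) := by
  unfold MemLp
  rw [eLpNorm_expMul_mul, aestronglyMeasurable_weight_iff]
  refine and_congr_left fun _ => ⟨fun h => ?_, fun h => ?_⟩
  · refine ((continuous_expMul c).aestronglyMeasurable.mul h).congr (.of_forall fun t => ?_)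
    simp only [Pi.mul_apply, ← mul_assoc, expMul_mul_expMul_neg, one_mul]
  · exact (continuous_expMul (-c)).aestronglyMeasurable.mul h

/-- The unitary map `f ↦ e^{-ct} f` of `ℍ_c` onto `L²(ℝ)`. -/
def weightEquiv (c : ℝ) : Hc c ≃ₗᵢ[ℂ] Lp ℂ 2 (volume : Measure ℝ) :=
  LinearIsometryEquiv.ofSurjective
    { toFun := fun f => ((memLp_expMul_mul_iff c).2 (Lp.memLp f)).toLp _
      map_add' := by
        intro f g
        rw [← MemLp.toLp_add, MemLp.toLp_eq_toLp_iff]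
        filter_upwards [(ae_weight_iff c).1 (Lp.coeFn_add f g)] with t ht
        rw [ht]
        simp only [Pi.add_apply]
        ring
      map_smul' := by
        intro a f
        rw [RingHom.id_apply, ← MemLp.toLp_const_smul, MemLp.toLp_eq_toLp_iff]
        filter_upwards [(ae_weight_iff c).1 (Lp.coeFn_smul a f)] with t ht
        rw [ht]
        simp only [Pi.smul_apply, smul_eq_mul]
        ring
      norm_map' := by
        intro f
        change ‖((memLp_expMul_mul_iff c).2 (Lp.memLp f)).toLp _‖ = ‖f‖
        rw [Lp.norm_toLp, eLpNorm_expMul_mul, Lp.norm_def] }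
    (by
      intro h
      have he : ∀ t, expMul (-c) t * (expMul c t * h t) = h t := fun t => by
        rw [← mul_assoc, expMul_neg_mul_expMul, one_mul]
      have hm : MemLp (fun t => expMul c t * h t) 2 (weight c) := by
        rw [← memLp_expMul_mul_iff]
        simpa only [he] using Lp.memLp h
      refine ⟨hm.toLp _, Lp.ext ?_⟩
      refine (MemLp.coeFn_toLp ((memLp_expMul_mul_iff c).2 (Lp.memLp (hm.toLp _)))).trans ?_
      filter_upwards [(ae_weight_iff c).1 hm.coeFn_toLp] with t ht
      rw [ht, he])

lemma coeFn_weightEquiv (c : ℝ) (f : Hc c) :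
    weightEquiv c f =ᵐ[volume] fun t => expMul (-c) t * f t :=
  MemLp.coeFn_toLp ((memLp_expMul_mul_iff c).2 (Lp.memLp f))

lemma locallyIntegrable_coeFn {c : ℝ} (f : Hc c) : LocallyIntegrable f := by
  have h : LocallyIntegrable (fun t => expMul (-c) t * f t) :=
    ((memLp_expMul_mul_iff c).2 (Lp.memLp f)).locallyIntegrable one_le_two
  refine (h.continuous_mul (continuous_expMul c)).congr (.of_forall fun t => ?_)
  simp only [← mul_assoc, expMul_mul_expMul_neg, one_mul]

/-- The Leibniz rule for the product with an exponential. -/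
lemma HasWeakDeriv.expMul_mul {f k : ℝ → ℂ} (hf : LocallyIntegrable f) (hk : LocallyIntegrable k)
    (h : HasWeakDeriv f k) (a : ℝ) :
    HasWeakDeriv (fun t => expMul a t * f t) fun t => expMul a t * k t + a * (expMul a t * f t) := by
  intro χ hχ hc
  have h1 := h _ (hχ.mul (contDiff_expMul a)) hc.mul_right
  have hd : ∀ t, deriv (fun s => χ s * expMul a s) t * f t =
      deriv χ t * (expMul a t * f t) + χ t * (a * (expMul a t * f t)) := fun t => by
    rw [((hχ.differentiable (by simp) t).hasDerivAt.fun_mul (hasDerivAt_expMul a t)).deriv]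
    ring
  have hf' := hf.continuous_mul (continuous_expMul a)
  have hi1 := integrable_mul_of_hasCompactSupport hf' (hχ.continuous_deriv (by simp)) hc.deriv
  have hi2 := integrable_mul_of_hasCompactSupport
    (hf'.continuous_mul (continuous_const (y := (a : ℂ)))) hχ.continuous hc
  have hi3 := integrable_mul_of_hasCompactSupport (hk.continuous_mul (continuous_expMul a))
    hχ.continuous hc
  simp only [hd] at h1
  rw [integral_add hi1 hi2] at h1
  simp only [mul_add]
  rw [integral_add hi3 hi2]
  simp only [mul_assoc] at h1 ⊢
  linear_combination h1

/-- The Leibniz rule `(e^{-ct} f)' = e^{-ct} f' - c e^{-ct} f`: conjugation by the weight turns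
`d/dt` into `d/dt + c`. -/
lemma hasWeakDeriv_weightEquiv_iff (c : ℝ) {f k : Hc c} :
    HasWeakDeriv (weightEquiv c f) (weightEquiv c k - (c : ℂ) • weightEquiv c f :
      Lp ℂ 2 (volume : Measure ℝ)) ↔ HasWeakDeriv f k := by
  have e : ((weightEquiv c k - (c : ℂ) • weightEquiv c f : Lp ℂ 2 (volume : Measure ℝ)) : ℝ → ℂ)
      =ᵐ[volume] fun t => expMul (-c) t * k t + (-c : ℝ) * (expMul (-c) t * f t) := by
    filter_upwards [Lp.coeFn_sub (weightEquiv c k) ((c : ℂ) • weightEquiv c f),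
      Lp.coeFn_smul (c : ℂ) (weightEquiv c f), coeFn_weightEquiv c f, coeFn_weightEquiv c k]
      with t h1 h2 h3 h4
    rw [h1, Pi.sub_apply, h2, Pi.smul_apply, h3, h4, smul_eq_mul]
    push_cast
    ring
  have hf := locallyIntegrable_coeFn f
  have hk := locallyIntegrable_coeFn k
  constructor
  · intro h
    have h1 := h.congr_ae (coeFn_weightEquiv c f) e
    have hf' := hf.continuous_mul (continuous_expMul (-c))
    have hk' : LocallyIntegrable
        fun t => expMul (-c) t * k t + (-c : ℝ) * (expMul (-c) t * f t) :=
      (hk.continuous_mul (continuous_expMul (-c))).add (hf'.continuous_mul continuous_const)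
    have h2 := h1.expMul_mul hf' hk' c
    refine h2.congr_ae (.of_forall fun t => ?_) (.of_forall fun t => ?_)
    · simp only [← mul_assoc, expMul_mul_expMul_neg, one_mul]
    · have := expMul_mul_expMul_neg c t
      push_cast
      linear_combination (k t) * this
  · intro h
    exact (h.expMul_mul hf hk (-c)).congr_ae (coeFn_weightEquiv c f).symm e.symm

/-- The graph of the infinitesimal shift is that of the weak derivative. -/
lemma mem_graph_infinitesimalShift_iff {c : ℝ} {f k : Hc c} :
    (f, k) ∈ (infinitesimalShift c).graph ↔ HasWeakDeriv f k := by
  rw [LinearPMap.mem_graph_iff]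
  constructor
  · rintro ⟨u, rfl, rfl⟩
    have hF := u.2.choose_spec
    exact hF.absCont.hasWeakDeriv.congr_ae ((ae_weight_iff c).1 hF.ae_eq.symm)
      ((ae_weight_iff c).1 hF.memLp_deriv.coeFn_toLp.symm)
  · intro h
    obtain ⟨F, hF, hfF, hFk⟩ :=
      h.exists_locallyAbsCont (locallyIntegrable_coeFn f) (locallyIntegrable_coeFn k)
    have hFk' : deriv F =ᵐ[weight c] k := (ae_weight_iff c).2 hFk
    have hrep : IsACRep c f F := ⟨hF, (ae_weight_iff c).2 hfF, (Lp.memLp k).ae_eq hFk'.symm⟩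
    have hmem : f ∈ (infinitesimalShift c).domain := ⟨F, hrep⟩
    refine ⟨⟨f, hmem⟩, rfl, Lp.ext ?_⟩
    refine (MemLp.coeFn_toLp (Exists.choose_spec hmem).memLp_deriv).trans ?_
    rw [(Exists.choose_spec hmem).unique hrep]
    exact hFk'

/-- The symbol `c + 2 π i ξ` of the infinitesimal shift. -/
def shiftSymbol (c : ℝ) (ξ : ℝ) : ℂ := c + 2 * Real.pi * Complex.I * ξ

lemma continuous_shiftSymbol (c : ℝ) : Continuous (shiftSymbol c) := by
  unfold shiftSymbol
  fun_prop

/-- The Fourier transform diagonalises the infinitesimal shift. -/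
def fourierRepresentation (c : ℝ) : SpectralRepresentation (infinitesimalShift c) where
  X := ℝ
  μ := volume
  g := shiftSymbol c
  aemeasurable_g := (continuous_shiftSymbol c).aemeasurable
  U := (weightEquiv c).trans (Lp.fourierTransformₗᵢ ℝ ℂ)
  eq_conj := by
    -- Comparing graphs settles domains and values together.
    refine LinearPMap.eq_of_eq_graph (Submodule.ext fun ⟨f, k⟩ => ?_)
    rw [mem_graph_infinitesimalShift_iff, mem_graph_unitaryConj_iff, mem_graph_mulOperator_iff,
      ← hasWeakDeriv_weightEquiv_iff, hasWeakDeriv_iff_fourier]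
    set u := weightEquiv c f
    set v := weightEquiv c k
    change ((Lp.fourierTransformₗᵢ ℝ ℂ (v - (c : ℂ) • u) : Lp ℂ 2 (volume : Measure ℝ)) : ℝ → ℂ)
      =ᵐ[volume] (fun ξ => 2 * Real.pi * Complex.I * ξ * Lp.fourierTransformₗᵢ ℝ ℂ u ξ) ↔
      ((Lp.fourierTransformₗᵢ ℝ ℂ v : Lp ℂ 2 (volume : Measure ℝ)) : ℝ → ℂ) =ᵐ[volume]
        fun ξ => shiftSymbol c ξ * Lp.fourierTransformₗᵢ ℝ ℂ u ξ
    rw [map_sub, map_smul]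
    refine Filter.eventually_congr ?_
    filter_upwards [Lp.coeFn_sub (Lp.fourierTransformₗᵢ ℝ ℂ v)
      ((c : ℂ) • Lp.fourierTransformₗᵢ ℝ ℂ u), Lp.coeFn_smul (c : ℂ) (Lp.fourierTransformₗᵢ ℝ ℂ u)]
      with ξ h1 h2
    rw [h1, Pi.sub_apply, h2, Pi.smul_apply, smul_eq_mul, sub_eq_iff_eq_add, shiftSymbol]
    ring_nf

end Weight

open Filter Topology

/-! ### Essential range of a composition -/

section SpectralMapping

variable {X : Type*} [MeasurableSpace X] {μ : Measure X} {g : X → ℂ}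

lemma aemeasurable_comp_of_continuousOn {φ : ℂ → ℂ} {S : Set ℂ} (hg : AEMeasurable g μ)
    (hS : MeasurableSet S) (hgS : ∀ᵐ x ∂μ, g x ∈ S) (hφ : ContinuousOn φ S) :
    AEMeasurable (φ ∘ g) μ := by
  classical
  have h : Measurable (S.piecewise φ 0) := hφ.measurable_piecewise continuousOn_const hS
  refine (h.comp_aemeasurable hg).congr ?_
  filter_upwards [hgS] with x hx
  simp [hx]

/-- The spectral mapping theorem for essential ranges. -/
lemma support_map_comp {φ : ℂ → ℂ} (hg : AEMeasurable g μ)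
    (hφ : ContinuousOn φ (μ.map g).support) :
    (μ.map (φ ∘ g)).support = closure (φ '' (μ.map g).support) := by
  have hgS : ∀ᵐ x ∂μ, g x ∈ (μ.map g).support :=
    ae_of_ae_map hg (Measure.support_mem_ae (μ := μ.map g))
  have hm : AEMeasurable (φ ∘ g) μ := aemeasurable_comp_of_continuousOn hg
    Measure.isClosed_support.measurableSet hgS hφ
  refine Set.Subset.antisymm (Measure.support_subset_of_isClosed isClosed_closure ?_)
    (closure_minimal ?_ Measure.isClosed_support)
  · refine (ae_map_iff hm isClosed_closure.measurableSet).2 ?_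
    filter_upwards [hgS] with x hx
    exact subset_closure ⟨g x, hx, rfl⟩
  · rintro _ ⟨s, hs, rfl⟩
    rw [mem_support_map_iff hm]
    intro ε hε h0
    obtain ⟨δ, hδ, hδε⟩ := Metric.continuousWithinAt_iff.1 (hφ s hs) ε hε
    refine (mem_support_map_iff hg).1 hs δ hδ ?_
    refine measure_mono_null_ae ?_ h0
    filter_upwards [hgS] with x hx h1
    have := hδε hx (by rw [dist_eq_norm]; exact h1)
    rwa [dist_eq_norm] at this

end SpectralMapping

/-! ### Spectrum and eigenvalues of the shift -/

section Line

lemma isClosed_verticalLine (c : ℝ) : IsClosed (verticalLine c) :=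
  isClosed_eq Complex.continuous_re continuous_const

lemma shiftSymbol_re (c ξ : ℝ) : (shiftSymbol c ξ).re = c := by
  simp [shiftSymbol]

lemma shiftSymbol_im (c ξ : ℝ) : (shiftSymbol c ξ).im = 2 * Real.pi * ξ := by
  simp [shiftSymbol]

lemma shiftSymbol_mem (c ξ : ℝ) : shiftSymbol c ξ ∈ verticalLine c := shiftSymbol_re c ξ

lemma exists_shiftSymbol_eq {c : ℝ} {s : ℂ} (hs : s ∈ verticalLine c) :
    ∃ ξ, shiftSymbol c ξ = s := by
  refine ⟨s.im / (2 * Real.pi), Complex.ext ?_ ?_⟩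
  · rw [shiftSymbol_re, show s.re = c from hs]
  · rw [shiftSymbol_im]
    field_simp

lemma shiftSymbol_injective (c : ℝ) : Function.Injective (shiftSymbol c) := by
  intro ξ η h
  have h1 := congrArg Complex.im h
  rw [shiftSymbol_im, shiftSymbol_im] at h1
  exact mul_left_cancel₀ (by positivity) h1

/-- Restricts statements about punctured neighbourhoods in `ℂ`, such as those on meromorphic order,
to the line. -/
lemma tendsto_shiftSymbol (c ξ : ℝ) :
    Tendsto (shiftSymbol c) (𝓝[≠] ξ) (𝓝[≠] (shiftSymbol c ξ)) :=
  tendsto_nhdsWithin_of_tendsto_nhds_of_eventually_within _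
    ((continuous_shiftSymbol c).tendsto ξ |>.mono_left nhdsWithin_le_nhds)
    (eventually_mem_nhdsWithin.mono fun _ h => (shiftSymbol_injective c).ne h)

lemma support_map_shiftSymbol (c : ℝ) :
    (volume.map (shiftSymbol c)).support = verticalLine c := by
  have hc := continuous_shiftSymbol c
  refine Set.Subset.antisymm
    (Measure.support_subset_of_isClosed (isClosed_verticalLine c) ?_) fun s hs => ?_
  · exact (ae_map_iff hc.aemeasurable (isClosed_verticalLine c).measurableSet).2
      (.of_forall (shiftSymbol_mem c))
  · obtain ⟨ξ, rfl⟩ := exists_shiftSymbol_eq hs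
    rw [mem_support_map_iff hc.aemeasurable]
    intro ε hε
    refine (IsOpen.measure_pos volume (isOpen_lt (by fun_prop) continuous_const) ⟨ξ, ?_⟩).ne'
    simpa using hε

variable {c : ℝ} (R : SpectralRepresentation (infinitesimalShift c))

/-- The spectrum of the infinitesimal shift is the line `{Re s = c}`. -/
lemma support_map_infinitesimalShift : (R.μ.map R.g).support = verticalLine c := by
  rw [R.support_eq (fourierRepresentation c)]
  exact support_map_shiftSymbol c

/-- The infinitesimal shift has no eigenvalues. -/
lemma ae_ne_infinitesimalShift (z : ℂ) : ∀ᵐ x ∂(R.μ), R.g x ≠ z := by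
  rw [R.ae_ne_iff (fourierRepresentation c)]
  change ∀ᵐ ξ, shiftSymbol c ξ ≠ z
  rw [ae_iff]
  refine Set.Subsingleton.measure_zero (fun ξ hξ η hη => shiftSymbol_injective c ?_) _
  simp only [not_not, Set.mem_ofPred_eq] at hξ hη
  rw [hξ, hη]

end Line

/-! ### Symbols of truncated shifts -/

section Cutoff

variable {c T : ℝ} {φ : ℂ → ℂ}

/-- A meromorphic cut-off takes the value `1` at most countably often. -/
lemma IsCutoff.countable_eq_one (hφ : IsCutoff 1 T φ) (hT : 0 < T) :
    {s ∈ verticalLine 1 | φ s = 1}.Countable := by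
  obtain ⟨V, G, -, hVc, hV, hG, hGφ⟩ := hφ.meromorphic rfl
  have hG1 : MeromorphicOn (fun z => G z - 1) V := fun z hz => (hG z hz).sub (.const 1 z)
  -- `φ` is not constantly `1` on the line, since its image is dense in a segment containing `1 +
  -- iT` with `T > 0`.
  obtain ⟨s, hs, hs1⟩ : ∃ s ∈ verticalLine 1, φ s ≠ 1 := by
    by_contra! h
    have h1 : closure (φ '' verticalLine 1) ⊆ {1} :=
      closure_minimal (by rintro _ ⟨s, hs, rfl⟩; exact h s hs) isClosed_singleton
    rw [hφ.closure_image] at h1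
    have h2 : (1 + T * Complex.I : ℂ) = 1 := h1 (by simp [abs_of_pos hT])
    simp [hT.ne'] at h2
  -- Infinite order would force `G = 1` near `s`, against the continuity of `φ` along the line.
  -- Connectedness of `V` then makes the order of `G - 1` finite everywhere.
  have hs' : meromorphicOrderAt (fun z => G z - 1) s ≠ ⊤ := by
    obtain ⟨ξ, rfl⟩ := exists_shiftSymbol_eq hs
    intro htop
    have h1 := (tendsto_shiftSymbol 1 ξ).eventually (meromorphicOrderAt_eq_top_iff.1 htop)
    have hcont : Continuous (φ ∘ shiftSymbol 1) :=
      hφ.continuousOn.comp_continuous (continuous_shiftSymbol 1) (shiftSymbol_mem 1)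
    have h2 : ∀ᶠ η in 𝓝[≠] ξ, (φ ∘ shiftSymbol 1) η ≠ 1 :=
      (hcont.continuousAt.eventually_ne hs1).filter_mono nhdsWithin_le_nhds
    obtain ⟨η, h3, h4⟩ := (h1.and h2).exists
    rw [hGφ (shiftSymbol_mem 1 η), sub_eq_zero] at h3
    exact h4 h3
  -- Finite order isolates each solution of `φ = 1`, and a discrete subspace of `ℂ` is countable.
  have hdisc : DiscreteTopology {s ∈ verticalLine 1 | φ s = 1} := by
    rw [discreteTopology_subtype_iff]
    rintro z ⟨hz, -⟩
    have hz' := hG1.meromorphicOrderAt_ne_top_of_isPreconnected hVc.isPreconnected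
      (hV hs) (hV hz) hs'
    rw [← disjoint_iff, disjoint_principal_right]
    filter_upwards [(meromorphicOrderAt_ne_top_iff_eventually_ne_zero (hG1 z (hV hz))).1 hz']
      with w hw hw'
    exact hw (by rw [hGφ hw'.1, hw'.2, sub_self])
  exact Set.countable_coe_iff.1 countable_of_Lindelof_of_discrete

/-- The essential properties of the symbol of a truncated infinitesimal shift: its essential range
is the segment, and it avoids the pole of `ζ`. -/
lemma IsCutoff.truncatedShift (hφ : IsCutoff c T φ) (hT : 0 < T) :
    ∃ R : SpectralRepresentation (truncatedShift c φ),
      (R.μ.map R.g).support = {s : ℂ | s.re = c ∧ |s.im| ≤ T} ∧ ∀ᵐ x ∂(R.μ), R.g x ≠ 1 := by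
  obtain ⟨R, hR⟩ := exists_functionalCalculus_eq ⟨fourierRepresentation c⟩ φ
  rw [SpectralOperator.truncatedShift, hR]
  have hsupp := support_map_infinitesimalShift R
  have hline : ∀ᵐ x ∂(R.μ), R.g x ∈ verticalLine c := hsupp ▸ R.ae_mem_support
  have hm : AEMeasurable (φ ∘ R.g) R.μ := aemeasurable_comp_of_continuousOn R.aemeasurable_g
    (isClosed_verticalLine c).measurableSet hline hφ.continuousOn
  have hS : (R.μ.map (φ ∘ R.g)).support = {s : ℂ | s.re = c ∧ |s.im| ≤ T} := by
    rw [support_map_comp R.aemeasurable_g (hsupp ▸ hφ.continuousOn), hsupp, hφ.closure_image]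
  refine ⟨R.comp φ hm, hS, ?_⟩
  by_cases hc : c = 1
  · subst hc
    have h := (ae_ball_iff (hφ.countable_eq_one hT)).2
      fun z _ => ae_ne_infinitesimalShift R z
    filter_upwards [h, hline] with x hx hxl h1
    exact hx (R.g x) ⟨hxl, h1⟩ rfl
  -- For `c ≠ 1` the segment does not contain `1`.
  · filter_upwards [(R.comp φ hm).ae_mem_support] with x hx h1
    have hx' : (R.comp φ hm).g x ∈ (R.μ.map (φ ∘ R.g)).support := hx
    rw [hS, h1] at hx'
    exact hc (by simpa using hx'.1.symm)

end Cutoff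

/-! ### Lower bounds for `ζ` and invertibility of truncations -/

section Zeta

lemma continuousAt_riemannZeta {s : ℂ} (hs : s ≠ 1) : ContinuousAt riemannZeta s :=
  (differentiableAt_riemannZeta hs).continuousAt

lemma measurable_riemannZeta : Measurable riemannZeta := by
  refine measurable_of_continuousOn_compl_singleton 1 fun s hs => ?_
  exact (continuousAt_riemannZeta hs).continuousWithinAt

/-- Away from its zeros, and in particular near its pole, `ζ` is locally bounded below. -/
lemma eventually_le_norm_riemannZeta {s : ℂ} (hs : s ≠ 1 → riemannZeta s ≠ 0) :
    ∃ ε : ℝ, 0 < ε ∧ ∀ᶠ z in 𝓝 s, z ≠ 1 → ε ≤ ‖riemannZeta z‖ := by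
  by_cases h1 : s = 1
  · subst h1
    -- Near the pole `‖(z - 1) ζ(z)‖ > 1/2` and `‖z - 1‖ < 1/2`, hence `‖ζ(z)‖ ≥ 1`.
    refine ⟨1, one_pos, ?_⟩
    have h := riemannZeta_residue_one.norm.eventually (lt_mem_nhds (a := 1 / 2) (by norm_num))
    have h2 : ∀ᶠ z : ℂ in 𝓝 1, ‖z - 1‖ < 1 / 2 := by
      filter_upwards [Metric.ball_mem_nhds (1 : ℂ) (ε := 1 / 2) (by norm_num)] with z hz
      rwa [← dist_eq_norm]
    filter_upwards [eventually_nhdsWithin_iff.1 h, h2] with z hz hz2 hz1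
    have h3 := hz hz1
    rw [norm_mul] at h3
    by_contra! hlt
    nlinarith [norm_nonneg (z - 1), norm_nonneg (riemannZeta z)]
  · have h0 : 0 < ‖riemannZeta s‖ := norm_pos_iff.2 (hs h1)
    refine ⟨‖riemannZeta s‖ / 2, half_pos h0, ?_⟩
    have h := (continuousAt_riemannZeta h1).norm.eventually (lt_mem_nhds (half_lt_self h0))
    filter_upwards [h] with z hz _
    exact hz.le

lemma exists_le_norm_riemannZeta {S : Set ℂ} (hS : IsCompact S)
    (h : ∀ s ∈ S, s ≠ 1 → riemannZeta s ≠ 0) :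
    ∃ ε : ℝ, 0 < ε ∧ ∀ s ∈ S, s ≠ 1 → ε ≤ ‖riemannZeta s‖ := by
  refine hS.induction_on (p := fun t => ∃ ε : ℝ, 0 < ε ∧ ∀ s ∈ t, s ≠ 1 → ε ≤ ‖riemannZeta s‖)
    ⟨1, one_pos, by simp⟩ ?_ ?_ ?_
  · rintro s t hst ⟨ε, hε, H⟩
    exact ⟨ε, hε, fun z hz => H z (hst hz)⟩
  · rintro s t ⟨ε, hε, H⟩ ⟨δ, hδ, H'⟩
    refine ⟨min ε δ, lt_min hε hδ, fun z hz h1 => ?_⟩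
    rcases hz with hz | hz
    · exact (min_le_left _ _).trans (H z hz h1)
    · exact (min_le_right _ _).trans (H' z hz h1)
  · intro s hs
    obtain ⟨ε, hε, H⟩ := eventually_le_norm_riemannZeta (h s hs)
    exact ⟨_, nhdsWithin_le_nhds H, ε, hε, fun z hz => hz⟩

lemma isCompact_segment (c T : ℝ) : IsCompact {s : ℂ | s.re = c ∧ |s.im| ≤ T} := by
  have h : {s : ℂ | s.re = c ∧ |s.im| ≤ T} = Set.Icc c c ×ℂ Set.Icc (-T) T := by
    ext s
    simp [Complex.mem_reProdIm, abs_le]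
  rw [h]
  exact isCompact_Icc.reProdIm isCompact_Icc

variable {c T : ℝ} {φ : ℂ → ℂ}

/-- A truncation of the spectral operator is invertible iff `ζ` has no zeros on the segment. -/
lemma IsCutoff.isInvertible_truncatedSpectralOperator_iff (hφ : IsCutoff c T φ) (hT : 0 < T) :
    IsInvertible (truncatedSpectralOperator c φ) ↔
      ∀ s : ℂ, s.re = c → |s.im| ≤ T → s ≠ 1 → riemannZeta s ≠ 0 := by
  obtain ⟨R₀, hsupp₀, hne₀⟩ := hφ.truncatedShift hT
  -- `R` need not be `R₀`. Only the essential range and the absence of the eigenvalue `1` carry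
  -- over.
  obtain ⟨R, hR⟩ := exists_functionalCalculus_eq ⟨R₀⟩ riemannZeta
  have hsupp := (R.support_eq R₀).trans hsupp₀
  have hne : ∀ᵐ x ∂(R.μ), R.g x ≠ 1 := (R.ae_ne_iff R₀).2 hne₀
  have hm : AEMeasurable (riemannZeta ∘ R.g) R.μ :=
    measurable_riemannZeta.comp_aemeasurable R.aemeasurable_g
  rw [truncatedSpectralOperator, hR, (R.comp riemannZeta hm).isInvertible_iff]
  change (∃ ε : ℝ, 0 < ε ∧ ∀ᵐ x ∂(R.μ), ε ≤ ‖riemannZeta (R.g x)‖) ↔ _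
  constructor
  · rintro ⟨ε, hε, hle⟩ s hsc hsT hs1 hs0
    -- Continuity at a zero keeps `‖ζ‖ < ε` on a ball, which the symbol meets in positive measure.
    have hs0' : ‖riemannZeta s‖ < ε := by rwa [hs0, norm_zero]
    have hlt := (continuousAt_riemannZeta hs1).norm.eventually (gt_mem_nhds hs0')
    obtain ⟨δ, hδ, hball⟩ := Metric.eventually_nhds_iff.1 hlt
    have hs : s ∈ (R.μ.map R.g).support := hsupp ▸ ⟨hsc, hsT⟩
    refine (mem_support_map_iff R.aemeasurable_g).1 hs δ hδ ?_
    refine measure_mono_null (fun x hx => ?_) (ae_iff.1 hle)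
    exact not_le.2 (hball (by rw [dist_eq_norm]; exact hx))
  · intro h
    obtain ⟨ε, hε, H⟩ := exists_le_norm_riemannZeta (isCompact_segment c T)
      fun s hs => h s hs.1 hs.2
    refine ⟨ε, hε, ?_⟩
    filter_upwards [hsupp ▸ R.ae_mem_support, hne] with x hx hx1
    exact H _ hx hx1

end Zeta

end SpectralOperator

end

theorem theorem7p3 (c : ℝ) (φ : ℝ → ℂ → ℂ)
    (hφ : ∀ T : ℝ, 0 < T → SpectralOperator.IsCutoff c T (φ T)) :
    SpectralOperator.IsQuasiInvertible c φ ↔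
      ∀ s : ℂ, s.re = c → s ≠ 1 → riemannZeta s ≠ 0 := by
  constructor
  · intro h s hs
    -- The added `1` keeps the height positive when `s` is real.
    have hT : 0 < |s.im| + 1 := by positivity
    exact ((hφ _ hT).isInvertible_truncatedSpectralOperator_iff hT).1 (h _ hT) s hs (by simp)
  · intro h T hT
    exact ((hφ T hT).isInvertible_truncatedSpectralOperator_iff hT).2 fun s hs _ => h s hs
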